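/- Let $\langle\cdot,\cdot\rangle$ be the standard Hermitian product on $\mathbb C^2$ (linear in the first entry) and $S^3\subset\mathbb C^2$ the unit sphere. A smooth curve $\gamma:\mathbb R\to S^3$ is unit-speed Legendrian if $\langle\gamma',\gamma\rangle=0$ and $\langle\gamma',\gamma'\rangle=1$; its curvature is $k=\operatorname{Im}\langle\gamma'',\gamma'\rangle$. It is closed of period $L$ if $L>0$ is its minimal period. The Maslov index of a closed $\gamma$ of period $L$ is the degree of the map $\theta:\mathbb R/L\mathbb Z\to\mathbb R/2\pi\mathbb Z$ with $\gamma'=e^{i\theta}\gamma^*$, where $(w_1,w_2)^*=(-\overline{w_2},\overline{w_1})$. An s-curve is a unit-speed Legendrian curve whose curvature is a non-constant periodic solution of $k'''+\tfrac32k^2k'+ak'=0$ for some constant $a$. It is of cnoidal type with modulus $(e_1,e_2,e_3)$, where $e_1>e_2$ and $e_3>0$, if $k$ solves this equation and $(k')^2+\tfrac14k^4+ak^2+bk+c=0$, with $a,b,c$ such that $\tfrac14x^4+ax^2+bx+c$ has the roots $e_1,\ e_2,\ -\tfrac12(e_1+e_2)\pm ie_3$. A $\phi$-curve of modulus $\mathbf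 e=(e_1,e_3)$ is a cnoidal s-curve with $e_2=-e_1$ (so $b=0$, $a=\tfrac14(e_3^2-e_1^2)$, $c=-\tfrac14e_1^2e_3^2$); a $\phi$-loop is a closed $\phi$-curve. Let $\mathcal C_0=\{(e_1,e_3):e_1>0,\ e_3>0\}$. For $\mathbf e\in\mathcal C_0$ put $|\mathbf e|=\sqrt{e_1^2+e_3^2}$, $m=e_1^2/|\mathbf e|^2$, $\ell=\tfrac12|\mathbf e|$, $\omega=\tfrac4\ell K(m)$, $\lambda=\tfrac14\sqrt{256-128a+16a^2-16c}=\tfrac14\sqrt{(|\mathbf e|^2-16)^2+64e_1^2}$, $k_{\mathbf e}(s)=-e_1\operatorname{cn}(\ell s,m)$, and $$\Lambda=\frac{16(4-a)+4\lambda k_{\mathbf e}}{4(8k_{\mathbf e}+4\lambda)},\qquad \Phi_1(\mathbf e)=\frac1{2\pi}\int_0^{\omega}k_{\mathbf e}\,ds,\qquad \Phi_2(\mathbf e)=\frac1{2\pi}\int_0^{\omega}\Lambda\,ds .$$ Here the parameter $m$ is the square of the Jacobi modulus, $K(m)=\int_0^{\pi/2}\frac{dt}{\sqrt{1-m\sin^2t}}$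 and $\Pi(n,m)=\int_0^{\pi/2}\frac{dt}{(1-n\sin^2t)\sqrt{1-m\sin^2t}}$. Define $\widetilde\Phi_2(\mathbf e)$ to be $\Phi_2(\mathbf e)$ if $|\mathbf e|<4$, $\Phi_2(\mathbf e)+\tfrac12$ if $|\mathbf e|=4$, and $\Phi_2(\mathbf e)+1$ if $|\mathbf e|>4$. Then: 1. For every $\mathbf e\in\mathcal C_0$, $k_{\mathbf e}$ and $\Lambda$ are integrable on $[0,\omega]$, $\Phi_1(\mathbf e)=0$, and $$\Phi_2(\mathbf e)=\begin{cases}\dfrac{\lambda}{2\pi|\mathbf e|}\left(K(m)-\dfrac{|\mathbf e|^2+16}{|\mathbf e|^2-16}\,\Pi\!\left(\dfrac{-64e_1^2}{(|\mathbf e|^2-16)^2},m\right)\right),&|\mathbf e|\ne4,\\[2ex]\dfrac{e_1}{4\pi}K\!\left(\dfrac{e_1^2}{16}\right),&|\mathbf e|=4.\end{cases}$$ 2. $\widetilde\Phi_2$ is real-analytic on $\mathcal C_0$. 3. If $\gamma$ is a $\phi$-curve of modulus $\mathbf e$, then $\mathbf e\in\mathcal C_0$, the curvature of $\gamma$ is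 $k_{\mathbf e}$ up to a translation of the parameter $s$, and its least period is $\omega$. 4. A $\phi$-curve of modulus $\mathbf e$ is closed if and only if $\Phi_2(\mathbf e)\in\mathbb Q$, equivalently if and only if $\widetilde\Phi_2(\mathbf e)\in\mathbb Q$. 5. The Maslov index of every $\phi$-loop is zero. -/

import Mathlib

open scoped ContDiff

namespace LegendrianS3

noncomputable section

/-- `ℂ²` with its standard Hermitian inner product. -/
abbrev C2 : Type := EuclideanSpace ℂ (Fin 2)

/-- A smooth unit-speed Legendrian curve in the unit sphere `S³ ⊂ ℂ²`. -/
structure IsUnitSpeedLegendrian (γ : ℝ → C2) : Prop where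
  smooth : ContDiff ℝ ∞ γ
  mem_sphere : ∀ s, inner ℂ (γ s) (γ s) = 1
  legendrian : ∀ s, inner ℂ (γ s) (deriv γ s) = 0
  unit_speed : ∀ s, inner ℂ (deriv γ s) (deriv γ s) = 1

/-- The curvature `Im ⟨γ'', γ'⟩` (Hermitian product linear in the first entry, that is
`inner ℂ γ' γ''` in Mathlib's convention), so that `γ'' = -γ + i κ γ'`. -/
def curvature (γ : ℝ → C2) (s : ℝ) : ℝ :=
  (inner ℂ (deriv γ s) (deriv (deriv γ) s)).im

/-- `γ` is a closed curve of (minimal) period `L`. -/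
def IsClosedOfPeriod (γ : ℝ → C2) (L : ℝ) : Prop :=
  IsLeast {T : ℝ | 0 < T ∧ Function.Periodic γ T} L

/-- `γ` is a closed curve. -/
def IsClosedCurve (γ : ℝ → C2) : Prop := ∃ L, IsClosedOfPeriod γ L

/-- The vector field `w ↦ w* = (-conj w₂, conj w₁)`. -/
def starVec (w : C2) : C2 := !₂[-(starRingEnd ℂ (w 1)), starRingEnd ℂ (w 0)]

/-- `μ` is the Maslov index of the closed unit-speed Legendrian curve `γ` of period `L`: the degree
of the map `θ : ℝ/Lℤ → ℝ/2πℤ` with `γ' = e^{iθ} γ*`, computed on a continuous lift of `θ`. -/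
def IsMaslovIndex (γ : ℝ → C2) (L : ℝ) (μ : ℤ) : Prop :=
  ∃ θ : ℝ → ℝ, Continuous θ ∧
    (∀ s, deriv γ s = Complex.exp ((θ s : ℂ) * Complex.I) • starVec (γ s)) ∧
    ∀ s, θ (s + L) = θ s + 2 * Real.pi * (μ : ℝ)

/-- The third-order equation `k''' + (3/2) k² k' + a k' = 0`. -/
def StationaryODE (a : ℝ) (k : ℝ → ℝ) : Prop :=
  ∀ s, deriv (deriv (deriv k)) s + 3 / 2 * k s ^ 2 * deriv k s + a * deriv k s = 0

/-- An s-curve: a unit-speed Legendrian curve whose curvature is a non-constant periodic solution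
of the stationary equation, for some value of the constant `a`. -/
structure IsSCurve (γ : ℝ → C2) : Prop where
  leg : IsUnitSpeedLegendrian γ
  nonconst : ¬ ∃ k₀ : ℝ, ∀ s, curvature γ s = k₀
  periodic : ∃ T : ℝ, 0 < T ∧ Function.Periodic (curvature γ) T
  stationary : ∃ a : ℝ, StationaryODE a (curvature γ)

/-- The phase polynomial `P_{a,b,c}(x) = x⁴/4 + a x² + b x + c`. -/
def phasePoly (a b c x : ℝ) : ℝ := 1 / 4 * x ^ 4 + a * x ^ 2 + b * x + c

/-- The coefficient `a` of the phase polynomial with roots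
`e₁`, `e₂`, `-(e₁ + e₂)/2 ± i e₃`. -/
def cnoidalA (e₁ e₂ e₃ : ℝ) : ℝ := (e₁ * e₂ + e₃ ^ 2 - 3 * ((e₁ + e₂) / 2) ^ 2) / 4

/-- The coefficient `b` of that polynomial. -/
def cnoidalB (e₁ e₂ e₃ : ℝ) : ℝ :=
  (e₁ + e₂) * (e₁ * e₂ - ((e₁ + e₂) / 2) ^ 2 - e₃ ^ 2) / 4

/-- The coefficient `c` of that polynomial. -/
def cnoidalC (e₁ e₂ e₃ : ℝ) : ℝ := e₁ * e₂ * (((e₁ + e₂) / 2) ^ 2 + e₃ ^ 2) / 4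

theorem phasePoly_cnoidal (e₁ e₂ e₃ x : ℝ) :
    phasePoly (cnoidalA e₁ e₂ e₃) (cnoidalB e₁ e₂ e₃) (cnoidalC e₁ e₂ e₃) x =
      1 / 4 * ((x - e₁) * (x - e₂) * ((x + (e₁ + e₂) / 2) ^ 2 + e₃ ^ 2)) := by
  unfold phasePoly cnoidalA cnoidalB cnoidalC
  ring

/-- An s-curve of cnoidal type with modulus `(e₁, e₂, e₃)`: its curvature `k` satisfies the
stationary equation, and `(k')² + P_{a,b,c}(k) = 0` where `P_{a,b,c}` has the real roots `e₁ > e₂`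
and the complex roots `-(e₁ + e₂)/2 ± i e₃`, with `e₃ > 0`. -/
structure IsCnoidalSCurve (γ : ℝ → C2) (e₁ e₂ e₃ : ℝ) : Prop where
  sCurve : IsSCurve γ
  lt : e₂ < e₁
  pos : 0 < e₃
  stationary : StationaryODE (cnoidalA e₁ e₂ e₃) (curvature γ)
  phase : ∀ s, deriv (curvature γ) s ^ 2 +
    phasePoly (cnoidalA e₁ e₂ e₃) (cnoidalB e₁ e₂ e₃) (cnoidalC e₁ e₂ e₃) (curvature γ s) = 0

/-- A φ-curve with modulus `e = (e₁, e₃)`: a cnoidal s-curve with `e₂ = -e₁`. -/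
def IsPhiCurve (γ : ℝ → C2) (e : ℝ × ℝ) : Prop := IsCnoidalSCurve γ e.1 (-e.1) e.2

/-- The moduli space of φ-curves: the open quadrant of pairs `(e₁, e₃)`. -/
def C0 : Set (ℝ × ℝ) := {e | 0 < e.1 ∧ 0 < e.2}

/-- The Euclidean length `|e| = √(e₁² + e₃²)`. -/
def modNorm (e : ℝ × ℝ) : ℝ := Real.sqrt (e.1 ^ 2 + e.2 ^ 2)

/-! Elliptic integrals and functions; the argument `m` is the square of the Jacobi modulus. -/

/-- Incomplete elliptic integral of the first kind `F(φ, m)`. -/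
def ellipticF (φ m : ℝ) : ℝ := ∫ t in (0 : ℝ)..φ, 1 / Real.sqrt (1 - m * Real.sin t ^ 2)

/-- Complete elliptic integral of the first kind `K(m)`. -/
def ellipticK (m : ℝ) : ℝ := ellipticF (Real.pi / 2) m

/-- Complete elliptic integral of the third kind `Π(n, m)`. -/
def ellipticPi (n m : ℝ) : ℝ :=
  ∫ t in (0 : ℝ)..(Real.pi / 2),
    1 / ((1 - n * Real.sin t ^ 2) * Real.sqrt (1 - m * Real.sin t ^ 2))

/-- The Jacobi amplitude `am(u, m)`: the inverse of `φ ↦ F(φ, m)`, which is a bijection of `ℝ` for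
`0 ≤ m < 1`. -/
def jacobiAm (u m : ℝ) : ℝ := Function.invFun (fun φ => ellipticF φ m) u

/-- The Jacobi elliptic function `cn(u, m) = cos (am(u, m))`. -/
def jacobiCn (u m : ℝ) : ℝ := Real.cos (jacobiAm u m)

/-- The parameter `m = e₁² / (e₁² + e₃²)`. -/
def phiM (e : ℝ × ℝ) : ℝ := e.1 ^ 2 / (e.1 ^ 2 + e.2 ^ 2)

/-- The parameter `ℓ = |e| / 2`. -/
def phiEll (e : ℝ × ℝ) : ℝ := 1 / 2 * modNorm e

/-- The wavelength `ω_e = 4 K(m) / ℓ`. -/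
def wavelength (e : ℝ × ℝ) : ℝ := 4 / phiEll e * ellipticK (phiM e)

/-- The function `-e₁ cn(ℓ s, m)`. -/
def phiCurvature (e : ℝ × ℝ) (s : ℝ) : ℝ := -e.1 * jacobiCn (phiEll e * s) (phiM e)

/-- The positive eigenvalue `λ` of the momentum, in terms of the phase coefficients. -/
def momentumEigenvalue (a b c : ℝ) : ℝ :=
  1 / 4 * Real.sqrt (256 - 128 * a + 16 * a ^ 2 + b ^ 2 - 16 * c)

/-- The value `(16(4 - a) + (b + 4λ) k) / (4 (8k + 4λ + b))`, as a function of the phase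
coefficients and of the value `k` of the curvature. -/
def lambdaOf (a b c k : ℝ) : ℝ :=
  (16 * (4 - a) + (b + 4 * momentumEigenvalue a b c) * k) /
    (4 * (8 * k + 4 * momentumEigenvalue a b c + b))

/-- The eigenvalue `λ` for a φ-curve of modulus `e`. -/
def phiLambda (e : ℝ × ℝ) : ℝ :=
  momentumEigenvalue (cnoidalA e.1 (-e.1) e.2) (cnoidalB e.1 (-e.1) e.2) (cnoidalC e.1 (-e.1) e.2)

/-- The function `Λ` along a φ-curve of modulus `e`. (If `|e| = 4` the quotient is `0 / 0` at the
discrete set of points where `cn = 1`; this does not affect its integral.) -/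
def bigLambda (e : ℝ × ℝ) (s : ℝ) : ℝ :=
  lambdaOf (cnoidalA e.1 (-e.1) e.2) (cnoidalB e.1 (-e.1) e.2) (cnoidalC e.1 (-e.1) e.2)
    (phiCurvature e s)

/-- The quantum of total curvature. -/
def Phi1 (e : ℝ × ℝ) : ℝ :=
  1 / (2 * Real.pi) * ∫ s in (0 : ℝ)..(wavelength e), phiCurvature e s

/-- The second quantum, `1/(2π) ∫₀^ω Λ ds`. -/
def Phi2 (e : ℝ × ℝ) : ℝ :=
  1 / (2 * Real.pi) * ∫ s in (0 : ℝ)..(wavelength e), bigLambda e s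

open Classical in
/-- The regularization of `Phi2`. -/
def Phi2Reg (e : ℝ × ℝ) : ℝ :=
  if modNorm e < 4 then Phi2 e
  else if modNorm e = 4 then Phi2 e + 1 / 2
  else Phi2 e + 1

end

end LegendrianS3

open LegendrianS3

/-! Along a unit-speed Legendrian curve `γ'' = -γ + i k γ'`, so both components solve the scalar
equation `p'' = -p + i k p'`, and closure is a Floquet problem over the period `ω` of `k`. The phase
equation and ODE uniqueness identify `k` with a translate of `k_e`. Since `k_e` changes sign under
translation by `ω/2`, its total integral vanishes. As `det(γ, γ') = e^{iθ}` with `θ' = k`, this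
gives Maslov index zero.

The system for `(p, p')` is skew-Hermitian, and a quaternionic conjugation produces a second,
orthogonal solution from a given one. With zero total curvature, a solution with multiplier `μ`
yields one with multiplier `conj μ`, so `γ` closes exactly when `μ` is a root of unity
(`IsUnitSpeedLegendrian.isClosedCurve_iff`). An explicit solution is `r e^{-iσ}` with `r² = 2k + λ`
and `σ' = Λ - k/4`, whence `μ² = e^{-4πi Φ₂}` (`exists_floquet`). For `|e| = 4` the function `2k +
λ` has double zeros and `r` must be a sign-changing root; squaring `μ` hides this sign.

For analyticity, folding the integral of `Λ` onto `[0, π/2]` and splitting it by partial fractions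
gives an integrand that stays regular across `|e| = 4`, plus an elementary integral equal to a
half-integer sign (`Phi2Reg_eq_integral`). The sign accounts for the jump of `Φ₂`. The regular part
is an analytic map into the Banach algebra `C([0, π/2])` followed by a continuous linear functional.
-/

namespace LegendrianS3

/-! ### Elliptic integrals of the first kind and the Jacobi amplitude -/

/-- The integrand's denominator `Δ(t) = √(1 - m sin² t)`. -/
noncomputable def ellipticDelta (m t : ℝ) : ℝ := Real.sqrt (1 - m * Real.sin t ^ 2)

section Amplitude

variable {m : ℝ}

theorem one_sub_mul_sin_sq_pos (h1 : m < 1) (t : ℝ) : 0 < 1 - m * Real.sin t ^ 2 := by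
  rcases (sq_nonneg (Real.sin t)).eq_or_lt with h | h
  · simp [← h]
  · nlinarith [Real.sin_sq_le_one t, mul_pos h (sub_pos.2 h1)]

theorem ellipticDelta_pos (h1 : m < 1) (t : ℝ) : 0 < ellipticDelta m t :=
  Real.sqrt_pos.2 (one_sub_mul_sin_sq_pos h1 t)

theorem ellipticDelta_le_one (h0 : 0 ≤ m) (t : ℝ) : ellipticDelta m t ≤ 1 :=
  Real.sqrt_le_one.2 (by nlinarith [mul_nonneg h0 (sq_nonneg (Real.sin t))])

theorem continuous_ellipticDelta (m : ℝ) : Continuous (ellipticDelta m) := by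
  unfold ellipticDelta; fun_prop

theorem continuous_one_div_ellipticDelta (h1 : m < 1) :
    Continuous fun t => 1 / ellipticDelta m t :=
  continuous_const.div (continuous_ellipticDelta m) fun t => (ellipticDelta_pos h1 t).ne'

theorem ellipticDelta_pi_sub (m t : ℝ) : ellipticDelta m (Real.pi - t) = ellipticDelta m t := by
  simp [ellipticDelta]

theorem ellipticDelta_add_pi (m t : ℝ) : ellipticDelta m (t + Real.pi) = ellipticDelta m t := by
  simp [ellipticDelta]

theorem ellipticF_eq (φ m : ℝ) : ellipticF φ m = ∫ t in (0 : ℝ)..φ, 1 / ellipticDelta m t := rfl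

theorem hasDerivAt_ellipticF (h1 : m < 1) (φ : ℝ) :
    HasDerivAt (fun φ => ellipticF φ m) (1 / ellipticDelta m φ) φ :=
  ((continuous_one_div_ellipticDelta h1).integral_hasStrictDerivAt 0 φ).hasDerivAt

theorem continuous_ellipticF (h1 : m < 1) : Continuous fun φ => ellipticF φ m :=
  continuous_iff_continuousAt.2 fun φ => (hasDerivAt_ellipticF h1 φ).continuousAt

theorem strictMono_ellipticF (h1 : m < 1) : StrictMono fun φ => ellipticF φ m :=
  strictMono_of_hasDerivAt_pos (fun φ => hasDerivAt_ellipticF h1 φ)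
    fun φ => one_div_pos.2 (ellipticDelta_pos h1 φ)

theorem ellipticF_zero (m : ℝ) : ellipticF 0 m = 0 := by simp [ellipticF]

theorem integral_zero_pi_of_pi_sub_eq {f : ℝ → ℝ} (hf : Continuous f) :
    ∫ t in (0 : ℝ)..Real.pi, f t = ∫ t in (0 : ℝ)..(Real.pi / 2), (f t + f (Real.pi - t)) := by
  have h : ∫ t in (0 : ℝ)..(Real.pi / 2), f (Real.pi - t) =
      ∫ t in (Real.pi / 2)..Real.pi, f t := by
    rw [intervalIntegral.integral_comp_sub_left (fun t => f t) Real.pi]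
    congr 1 <;> ring
  have hf' : Continuous fun t => f (Real.pi - t) := by fun_prop
  rw [intervalIntegral.integral_add (hf.intervalIntegrable _ _) (hf'.intervalIntegrable _ _), h,
    intervalIntegral.integral_add_adjacent_intervals (hf.intervalIntegrable _ _)
      (hf.intervalIntegrable _ _)]

theorem ellipticF_pi (h1 : m < 1) : ellipticF Real.pi m = 2 * ellipticK m := by
  rw [ellipticF_eq, integral_zero_pi_of_pi_sub_eq (continuous_one_div_ellipticDelta h1),
    ellipticK, ellipticF_eq, ← intervalIntegral.integral_const_mul]
  refine intervalIntegral.integral_congr fun t _ => ?_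
  simp only [ellipticDelta_pi_sub]
  ring

theorem ellipticF_add_pi (h1 : m < 1) (φ : ℝ) :
    ellipticF (φ + Real.pi) m = ellipticF φ m + 2 * ellipticK m := by
  have hc := continuous_one_div_ellipticDelta h1
  have hp : Function.Periodic (fun t => 1 / ellipticDelta m t) Real.pi := fun t => by
    simp only [ellipticDelta_add_pi]
  rw [← ellipticF_pi h1, ellipticF_eq, ellipticF_eq, ellipticF_eq,
    ← intervalIntegral.integral_add_adjacent_intervals (hc.intervalIntegrable 0 φ)
      (hc.intervalIntegrable φ (φ + Real.pi)), hp.intervalIntegral_add_eq φ 0, zero_add]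

theorem surjective_ellipticF (h0 : 0 ≤ m) (h1 : m < 1) :
    Function.Surjective fun φ => ellipticF φ m := by
  -- For `m ≥ 0` the integrand is at least `1`, so `F(φ, m) ≥ φ` for `φ ≥ 0` and `F(φ, m) ≤ φ` for
  -- `φ ≤ 0`, which gives both limits.
  have hmono : Monotone fun φ => ellipticF φ m - φ := by
    refine monotone_of_hasDerivAt_nonneg (f' := fun φ => 1 / ellipticDelta m φ - 1)
      (fun φ => (hasDerivAt_ellipticF h1 φ).sub (hasDerivAt_id φ)) fun φ => ?_
    have := one_le_one_div (ellipticDelta_pos h1 φ) (ellipticDelta_le_one h0 φ)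
    simpa using this
  refine (continuous_ellipticF h1).surjective ?_ ?_
  · refine Filter.tendsto_atTop_mono' _ ?_ Filter.tendsto_id
    filter_upwards [Filter.eventually_ge_atTop 0] with φ hφ
    have := hmono hφ
    simp only [ellipticF_zero] at this
    simpa using by linarith
  · refine Filter.tendsto_atBot_mono' _ ?_ Filter.tendsto_id
    filter_upwards [Filter.eventually_le_atBot 0] with φ hφ
    have := hmono hφ
    simp only [ellipticF_zero] at this
    simpa using by linarith

theorem ellipticF_jacobiAm (h0 : 0 ≤ m) (h1 : m < 1) (u : ℝ) : ellipticF (jacobiAm u m) m = u :=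
  Function.rightInverse_invFun (surjective_ellipticF h0 h1) u

theorem jacobiAm_ellipticF (h1 : m < 1) (φ : ℝ) : jacobiAm (ellipticF φ m) m = φ :=
  Function.leftInverse_invFun (strictMono_ellipticF h1).injective φ

theorem jacobiAm_zero (h1 : m < 1) : jacobiAm 0 m = 0 := by
  simpa [ellipticF_zero] using jacobiAm_ellipticF h1 0

theorem continuous_jacobiAm (h0 : 0 ≤ m) (h1 : m < 1) : Continuous fun u => jacobiAm u m := by
  let f := (strictMono_ellipticF h1).orderIsoOfSurjective _ (surjective_ellipticF h0 h1)
  have : (fun u => jacobiAm u m) = f.symm := by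
    funext u
    obtain ⟨φ, rfl⟩ := surjective_ellipticF h0 h1 u
    exact (jacobiAm_ellipticF h1 φ).trans (f.symm_apply_apply φ).symm
  rw [this]
  exact f.symm.continuous

theorem hasDerivAt_jacobiAm (h0 : 0 ≤ m) (h1 : m < 1) (u : ℝ) :
    HasDerivAt (fun u => jacobiAm u m) (ellipticDelta m (jacobiAm u m)) u := by
  have h := HasDerivAt.of_local_left_inverse (f := fun φ => ellipticF φ m)
    (continuous_jacobiAm h0 h1).continuousAt (hasDerivAt_ellipticF h1 (jacobiAm u m))
    (one_div_pos.2 (ellipticDelta_pos h1 _)).ne'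
    (Filter.Eventually.of_forall fun v => ellipticF_jacobiAm h0 h1 v)
  simpa using h

theorem jacobiAm_add_two_mul_ellipticK (h0 : 0 ≤ m) (h1 : m < 1) (u : ℝ) :
    jacobiAm (u + 2 * ellipticK m) m = jacobiAm u m + Real.pi := by
  obtain ⟨φ, rfl⟩ := surjective_ellipticF h0 h1 u
  simp only
  rw [← ellipticF_add_pi h1, jacobiAm_ellipticF h1, jacobiAm_ellipticF h1]

theorem ellipticK_pos (h1 : m < 1) : 0 < ellipticK m := by
  have := strictMono_ellipticF h1 (half_pos Real.pi_pos)
  simpa [ellipticF_zero, ellipticK] using this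

theorem ellipticF_nat_mul_pi (h1 : m < 1) (n : ℕ) :
    ellipticF (n * Real.pi) m = n * (2 * ellipticK m) := by
  induction n with
  | zero => simp [ellipticF_zero]
  | succ n ih =>
    push_cast
    rw [add_mul, one_mul, ellipticF_add_pi h1, ih]
    ring

end Amplitude

/-! ### The curvature function of a modulus -/

theorem cnoidalA_neg (e₁ e₃ : ℝ) : cnoidalA e₁ (-e₁) e₃ = (e₃ ^ 2 - e₁ ^ 2) / 4 := by
  unfold cnoidalA; ring

theorem cnoidalB_neg (e₁ e₃ : ℝ) : cnoidalB e₁ (-e₁) e₃ = 0 := by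
  unfold cnoidalB; ring

theorem cnoidalC_neg (e₁ e₃ : ℝ) : cnoidalC e₁ (-e₁) e₃ = -(e₁ ^ 2 * e₃ ^ 2) / 4 := by
  unfold cnoidalC; ring

/-- The function `√(e₃² + e₁² cos² t)`. -/
noncomputable def phiR (e : ℝ × ℝ) (t : ℝ) : ℝ :=
  Real.sqrt (e.2 ^ 2 + e.1 ^ 2 * Real.cos t ^ 2)

/-- The amplitude `am(ℓ s, m)` along a φ-curve. -/
noncomputable def phiAngle (e : ℝ × ℝ) (s : ℝ) : ℝ := jacobiAm (phiEll e * s) (phiM e)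

theorem phiCurvature_eq (e : ℝ × ℝ) (s : ℝ) :
    phiCurvature e s = -e.1 * Real.cos (phiAngle e s) := rfl

section Modulus

variable {e : ℝ × ℝ}

theorem modNorm_sq (e : ℝ × ℝ) : modNorm e ^ 2 = e.1 ^ 2 + e.2 ^ 2 :=
  Real.sq_sqrt (by positivity)

theorem modNorm_pos (he : e ∈ C0) : 0 < modNorm e :=
  Real.sqrt_pos.2 (by have := he.1; positivity)

theorem phiEll_pos (he : e ∈ C0) : 0 < phiEll e :=
  mul_pos (by norm_num) (modNorm_pos he)

theorem phiM_nonneg (e : ℝ × ℝ) : 0 ≤ phiM e := by unfold phiM; positivity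

theorem phiM_lt_one (he : e ∈ C0) : phiM e < 1 := by
  obtain ⟨h1, h2⟩ := he
  rw [phiM, div_lt_one (by positivity)]
  nlinarith

/-- Absorbing `|e|` into `Δ` removes the quotient `m` and leaves an expression in `e₁`, `e₃` alone.
-/
theorem modNorm_mul_ellipticDelta (e : ℝ × ℝ) (he : e ∈ C0) (t : ℝ) :
    modNorm e * ellipticDelta (phiM e) t = phiR e t := by
  rw [modNorm, ellipticDelta, phiR, ← Real.sqrt_mul (by positivity), phiM]
  have : 0 < e.1 ^ 2 + e.2 ^ 2 := by have := he.1; positivity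
  congr 1
  field_simp
  rw [Real.sin_sq]
  ring

theorem phiR_sq (e : ℝ × ℝ) (t : ℝ) : phiR e t ^ 2 = e.2 ^ 2 + e.1 ^ 2 * Real.cos t ^ 2 :=
  Real.sq_sqrt (by positivity)

theorem phiR_pos (he : e ∈ C0) (t : ℝ) : 0 < phiR e t :=
  Real.sqrt_pos.2 (by have := he.2; positivity)

theorem hasDerivAt_phiR (he : e ∈ C0) (t : ℝ) :
    HasDerivAt (phiR e) (-(e.1 ^ 2 * Real.cos t * Real.sin t) / phiR e t) t := by
  have h : HasDerivAt (fun t => e.2 ^ 2 + e.1 ^ 2 * Real.cos t ^ 2)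
      (e.1 ^ 2 * (2 * Real.cos t * -Real.sin t)) t := by
    simpa using (((Real.hasDerivAt_cos t).pow 2).const_mul (e.1 ^ 2)).const_add (e.2 ^ 2)
  have hpos : e.2 ^ 2 + e.1 ^ 2 * Real.cos t ^ 2 ≠ 0 := by
    rw [← phiR_sq]; exact pow_ne_zero 2 (phiR_pos he t).ne'
  refine (h.sqrt hpos).congr_deriv ?_
  rw [← phiR]
  have := (phiR_pos he t).ne'
  field_simp

theorem continuous_phiR (e : ℝ × ℝ) : Continuous (phiR e) := by unfold phiR; fun_prop

theorem hasDerivAt_phiAngle (he : e ∈ C0) (s : ℝ) :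
    HasDerivAt (phiAngle e) (phiR e (phiAngle e s) / 2) s := by
  have h := (hasDerivAt_jacobiAm (phiM_nonneg e) (phiM_lt_one he) (phiEll e * s)).comp s
    ((hasDerivAt_id s).const_mul (phiEll e))
  refine h.congr_deriv ?_
  rw [← modNorm_mul_ellipticDelta e he, phiAngle, phiEll]
  ring

theorem continuous_phiAngle (he : e ∈ C0) : Continuous (phiAngle e) :=
  continuous_iff_continuousAt.2 fun s => (hasDerivAt_phiAngle he s).continuousAt

theorem hasDerivAt_phiR_phiAngle (he : e ∈ C0) (s : ℝ) :
    HasDerivAt (fun s => phiR e (phiAngle e s))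
      (-(e.1 ^ 2 * Real.cos (phiAngle e s) * Real.sin (phiAngle e s)) / 2) s := by
  refine ((hasDerivAt_phiR he _).comp s (hasDerivAt_phiAngle he s)).congr_deriv ?_
  have := (phiR_pos he (phiAngle e s)).ne'
  field_simp

theorem hasDerivAt_phiCurvature (he : e ∈ C0) (s : ℝ) :
    HasDerivAt (phiCurvature e) (e.1 * Real.sin (phiAngle e s) * phiR e (phiAngle e s) / 2) s := by
  refine ((hasDerivAt_phiAngle he s).cos.const_mul (-e.1)).congr_deriv ?_
  ring

theorem continuous_phiCurvature (he : e ∈ C0) : Continuous (phiCurvature e) :=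
  continuous_iff_continuousAt.2 fun s => (hasDerivAt_phiCurvature he s).continuousAt

/-- This is the Duffing equation `k'' = -k³/2 - a k`, the once-integrated stationary equation; the
integration constant is zero because `b = 0`. -/
theorem hasDerivAt_deriv_phiCurvature (he : e ∈ C0) (s : ℝ) :
    HasDerivAt (fun s => e.1 * Real.sin (phiAngle e s) * phiR e (phiAngle e s) / 2)
      (-phiCurvature e s ^ 3 / 2 - (e.2 ^ 2 - e.1 ^ 2) / 4 * phiCurvature e s) s := by
  refine ((((hasDerivAt_phiAngle he s).sin.const_mul e.1).mul
    (hasDerivAt_phiR_phiAngle he s)).div_const 2).congr_deriv ?_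
  have h := phiR_sq e (phiAngle e s)
  have h' := Real.sin_sq_add_cos_sq (phiAngle e s)
  rw [phiCurvature_eq]
  linear_combination (e.1 * Real.cos (phiAngle e s) / 4) * h -
    e.1 ^ 3 * Real.cos (phiAngle e s) / 4 * h'

theorem phiAngle_add_half_wavelength (he : e ∈ C0) (s : ℝ) :
    phiAngle e (s + wavelength e / 2) = phiAngle e s + Real.pi := by
  rw [phiAngle, phiAngle, ← jacobiAm_add_two_mul_ellipticK (phiM_nonneg e) (phiM_lt_one he),
    wavelength]
  congr 1
  have := (phiEll_pos he).ne'
  field_simp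
  ring

theorem phiAngle_add_wavelength (he : e ∈ C0) (s : ℝ) :
    phiAngle e (s + wavelength e) = phiAngle e s + 2 * Real.pi := by
  rw [show s + wavelength e = s + wavelength e / 2 + wavelength e / 2 by ring,
    phiAngle_add_half_wavelength he, phiAngle_add_half_wavelength he]
  ring

theorem phiAngle_zero (he : e ∈ C0) : phiAngle e 0 = 0 := by
  rw [phiAngle, mul_zero, jacobiAm_zero (phiM_lt_one he)]

theorem wavelength_pos (he : e ∈ C0) : 0 < wavelength e :=
  mul_pos (div_pos (by norm_num) (phiEll_pos he)) (ellipticK_pos (phiM_lt_one he))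

theorem phiAngle_ellipticF (he : e ∈ C0) (t : ℝ) :
    phiAngle e (ellipticF t (phiM e) / phiEll e) = t := by
  rw [phiAngle, mul_div_cancel₀ _ (phiEll_pos he).ne', jacobiAm_ellipticF (phiM_lt_one he)]

theorem phiAngle_injective (he : e ∈ C0) : Function.Injective (phiAngle e) := by
  intro s t h
  have h' := congrArg (fun φ => ellipticF φ (phiM e)) h
  simp only [phiAngle, ellipticF_jacobiAm (phiM_nonneg e) (phiM_lt_one he)] at h'
  exact mul_left_cancel₀ (phiEll_pos he).ne' h'

theorem periodic_phiCurvature (he : e ∈ C0) :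
    Function.Periodic (phiCurvature e) (wavelength e) := fun s => by
  rw [phiCurvature_eq, phiCurvature_eq, phiAngle_add_wavelength he, Real.cos_add_two_pi]

theorem phiCurvature_add_half_wavelength (he : e ∈ C0) (s : ℝ) :
    phiCurvature e (s + wavelength e / 2) = -phiCurvature e s := by
  rw [phiCurvature_eq, phiCurvature_eq, phiAngle_add_half_wavelength he, Real.cos_add_pi]
  ring

/-- The value `k_e(0) = -e₁` recurs only when the amplitude is a multiple of `2π`, and `ω` is the
time the increasing amplitude takes to reach `2π`. -/
theorem isLeast_period_phiCurvature (he : e ∈ C0) :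
    IsLeast {T : ℝ | 0 < T ∧ Function.Periodic (phiCurvature e) T} (wavelength e) := by
  refine ⟨⟨wavelength_pos he, periodic_phiCurvature he⟩, fun T hT => ?_⟩
  have h := hT.2 0
  rw [zero_add, phiCurvature_eq, phiCurvature_eq, phiAngle_zero he, Real.cos_zero] at h
  have hc : Real.cos (phiAngle e T) = 1 := mul_left_cancel₀ (neg_ne_zero.2 he.1.ne') h
  obtain ⟨n, hn⟩ := (Real.cos_eq_one_iff _).1 hc
  have hmono := strictMono_ellipticF (phiM_lt_one he)
  have hF : ellipticF (phiAngle e T) (phiM e) = phiEll e * T :=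
    ellipticF_jacobiAm (phiM_nonneg e) (phiM_lt_one he) _
  have hpos : 0 < phiAngle e T := by
    rw [← hmono.lt_iff_lt]
    simp only [hF, ellipticF_zero]
    exact mul_pos (phiEll_pos he) hT.1
  have hn1 : (1 : ℝ) ≤ n := by
    rw [← hn] at hpos
    have : (0 : ℝ) < n := by
      by_contra hneg
      nlinarith [Real.pi_pos]
    exact_mod_cast this
  have hle : ellipticF ((2 : ℕ) * Real.pi) (phiM e) ≤ ellipticF (phiAngle e T) (phiM e) := by
    refine hmono.monotone ?_
    rw [← hn]
    push_cast
    nlinarith [Real.pi_pos]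
  rw [ellipticF_nat_mul_pi (phiM_lt_one he), hF] at hle
  rw [wavelength, div_mul_eq_mul_div, div_le_iff₀ (phiEll_pos he)]
  push_cast at hle
  linarith

/-- Integration over a wavelength, in terms of the amplitude. -/
theorem integral_wavelength_eq (he : e ∈ C0) {h : ℝ → ℝ} (hh : Continuous h) :
    ∫ s in (0 : ℝ)..wavelength e, h (phiAngle e s) =
      ∫ t in (0 : ℝ)..(2 * Real.pi), h t * (2 / phiR e t) := by
  have hm := phiM_lt_one he
  have hl := phiEll_pos he
  -- The substitution is `s = F(t, m)/ℓ`, the inverse of the amplitude.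
  have hderiv : ∀ t, HasDerivAt (fun t => ellipticF t (phiM e) / phiEll e) (2 / phiR e t) t := by
    intro t
    refine ((hasDerivAt_ellipticF hm t).div_const (phiEll e)).congr_deriv ?_
    rw [← modNorm_mul_ellipticDelta e he, phiEll]
    have := (modNorm_pos he).ne'
    have := (ellipticDelta_pos hm t).ne'
    field_simp
  have hcont : Continuous fun t => 2 / phiR e t :=
    continuous_const.div (continuous_phiR e) fun t => (phiR_pos he t).ne'
  have := intervalIntegral.integral_comp_mul_deriv (a := 0) (b := 2 * Real.pi)
    (fun t _ => hderiv t) hcont.continuousOn (hh.comp (continuous_phiAngle he))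
  simp only [Function.comp_apply, phiAngle_ellipticF he, ellipticF_zero, zero_div] at this
  rw [this]
  congr 1
  have h2 := ellipticF_nat_mul_pi hm 2
  push_cast at h2
  rw [h2, wavelength]
  ring

theorem integral_phiCurvature (he : e ∈ C0) :
    ∫ s in (0 : ℝ)..wavelength e, phiCurvature e s = 0 := by
  have hc := continuous_phiCurvature he
  rw [← intervalIntegral.integral_add_adjacent_intervals
    (hc.intervalIntegrable 0 (wavelength e / 2)) (hc.intervalIntegrable _ _)]
  have h : ∫ s in (0 : ℝ)..(wavelength e / 2), phiCurvature e (s + wavelength e / 2) =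
      ∫ s in (wavelength e / 2)..wavelength e, phiCurvature e s := by
    rw [intervalIntegral.integral_comp_add_right (fun s => phiCurvature e s)]
    congr 1 <;> ring
  rw [← h]
  simp only [phiCurvature_add_half_wavelength he, intervalIntegral.integral_neg]
  ring

end Modulus

/-! ### The second quantum -/

section Quantum

variable {e : ℝ × ℝ}

/-- This sum of squares gives `λ ≥ 2e₁` with equality exactly for `|e| = 4`, which decides whether
the denominator of `Λ` can vanish. -/
theorem phiLambda_sq (e : ℝ × ℝ) :
    16 * phiLambda e ^ 2 = (e.1 ^ 2 + e.2 ^ 2 - 16) ^ 2 + 64 * e.1 ^ 2 := by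
  rw [phiLambda, momentumEigenvalue, mul_pow, cnoidalA_neg, cnoidalB_neg, cnoidalC_neg,
    show (256 - 128 * ((e.2 ^ 2 - e.1 ^ 2) / 4) + 16 * ((e.2 ^ 2 - e.1 ^ 2) / 4) ^ 2 + 0 ^ 2 -
      16 * (-(e.1 ^ 2 * e.2 ^ 2) / 4)) = (e.1 ^ 2 + e.2 ^ 2 - 16) ^ 2 + 64 * e.1 ^ 2 by ring,
    Real.sq_sqrt (by positivity)]
  ring

theorem phiLambda_pos (he : e ∈ C0) : 0 < phiLambda e := by
  have h : 0 ≤ phiLambda e := by unfold phiLambda momentumEigenvalue; positivity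
  refine h.lt_of_ne fun h0 => ?_
  have := phiLambda_sq e
  rw [← h0] at this
  nlinarith [sq_nonneg (e.1 ^ 2 + e.2 ^ 2 - 16), pow_pos he.1 2]

theorem modNorm_eq_four_iff (he : e ∈ C0) : modNorm e = 4 ↔ e.1 ^ 2 + e.2 ^ 2 = 16 := by
  rw [← modNorm_sq]
  refine ⟨fun h => by rw [h]; norm_num, fun h => ?_⟩
  nlinarith [modNorm_pos he]

theorem phiLambda_eq_of_modNorm_eq (he : e ∈ C0) (h : modNorm e = 4) :
    phiLambda e = 2 * e.1 := by
  have h1 := phiLambda_sq e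
  rw [(modNorm_eq_four_iff he).1 h] at h1
  have := phiLambda_pos he
  have := he.1
  nlinarith

theorem two_mul_lt_phiLambda (he : e ∈ C0) (h : modNorm e ≠ 4) : 2 * e.1 < phiLambda e := by
  have h1 := phiLambda_sq e
  have h2 : 0 < (e.1 ^ 2 + e.2 ^ 2 - 16) ^ 2 := by
    have : e.1 ^ 2 + e.2 ^ 2 - 16 ≠ 0 := fun h' =>
      h ((modNorm_eq_four_iff he).2 (by linarith))
    positivity
  have := phiLambda_pos he
  have := he.1
  nlinarith

theorem phiLambda_add_mul_cos_pos (he : e ∈ C0) (h : modNorm e ≠ 4) {x : ℝ} (hx : |x| ≤ 1) :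
    0 < phiLambda e + 2 * e.1 * x := by
  have := two_mul_lt_phiLambda he h
  have := he.1
  nlinarith [(abs_le.1 hx).1]

/-- `Λ` as a function of the cosine of the amplitude. -/
noncomputable def lambdaCos (e : ℝ × ℝ) (x : ℝ) : ℝ :=
  ((4 - (e.2 ^ 2 - e.1 ^ 2) / 4) - phiLambda e * e.1 * x / 4) / (phiLambda e - 2 * e.1 * x)

theorem bigLambda_eq (e : ℝ × ℝ) (s : ℝ) :
    bigLambda e s = lambdaCos e (Real.cos (phiAngle e s)) := by
  rw [bigLambda, lambdaOf, ← phiLambda, lambdaCos, cnoidalA_neg, cnoidalB_neg, phiCurvature_eq,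
    ← mul_div_mul_left _ (phiLambda e - 2 * e.1 * Real.cos (phiAngle e s))
      (by norm_num : (16 : ℝ) ≠ 0)]
  congr 1 <;> ring

theorem continuous_lambdaCos_cos (he : e ∈ C0) (h : modNorm e ≠ 4) :
    Continuous fun t => lambdaCos e (Real.cos t) := by
  unfold lambdaCos
  refine Continuous.div (by fun_prop) (by fun_prop) fun t => ?_
  have := phiLambda_add_mul_cos_pos he h (x := -Real.cos t)
    (by rw [abs_neg]; exact Real.abs_cos_le_one t)
  linarith

theorem continuous_bigLambda (he : e ∈ C0) (h : modNorm e ≠ 4) : Continuous (bigLambda e) := by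
  rw [show bigLambda e = fun s => lambdaCos e (Real.cos (phiAngle e s)) from
    funext (bigLambda_eq e)]
  exact (continuous_lambdaCos_cos he h).comp (continuous_phiAngle he)

/-- With `λ = 2e₁` the numerator is `(e₁²/2)(1 - cos)` and the denominator `2e₁(1 - cos)`; the
common factor cancels. -/
theorem bigLambda_of_modNorm_eq (he : e ∈ C0) (h : modNorm e = 4) {s : ℝ}
    (hs : Real.cos (phiAngle e s) ≠ 1) : bigLambda e s = e.1 / 4 := by
  have h1 := (modNorm_eq_four_iff he).1 h
  have := he.1.ne'
  have h2 : (1 : ℝ) - Real.cos (phiAngle e s) ≠ 0 := sub_ne_zero.2 hs.symm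
  rw [bigLambda_eq, lambdaCos, phiLambda_eq_of_modNorm_eq he h, div_eq_div_iff _ (by norm_num)]
  · linear_combination (-1) * h1
  · rw [show 2 * e.1 - 2 * e.1 * Real.cos (phiAngle e s) =
      2 * e.1 * (1 - Real.cos (phiAngle e s)) by ring]
    positivity

theorem ae_bigLambda_eq (he : e ∈ C0) (h : modNorm e = 4) :
    ∀ᵐ s : ℝ, bigLambda e s = e.1 / 4 := by
  have hc : {s | Real.cos (phiAngle e s) = 1}.Countable := by
    have : {s | Real.cos (phiAngle e s) = 1} ⊆
        phiAngle e ⁻¹' Set.range fun n : ℤ => (n : ℝ) * (2 * Real.pi) := fun s hs =>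
      (Real.cos_eq_one_iff _).1 hs
    exact ((Set.countable_range _).preimage (phiAngle_injective he)).mono this
  filter_upwards [hc.ae_notMem MeasureTheory.volume] with s hs
  exact bigLambda_of_modNorm_eq he h hs

theorem intervalIntegrable_bigLambda (he : e ∈ C0) (a b : ℝ) :
    IntervalIntegrable (bigLambda e) MeasureTheory.volume a b := by
  by_cases h : modNorm e = 4
  · refine (intervalIntegrable_const (c := e.1 / 4)).congr_ae ?_
    exact MeasureTheory.ae_restrict_of_ae ((ae_bigLambda_eq he h).mono fun s hs => hs.symm)
  · exact (continuous_bigLambda he h).intervalIntegrable a b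

theorem integral_bigLambda_of_modNorm_eq (he : e ∈ C0) (h : modNorm e = 4) :
    ∫ s in (0 : ℝ)..wavelength e, bigLambda e s = wavelength e * (e.1 / 4) := by
  rw [intervalIntegral.integral_congr_ae ((ae_bigLambda_eq he h).mono fun s hs _ => hs)]
  rw [intervalIntegral.integral_const, sub_zero, smul_eq_mul]

theorem Phi2_of_modNorm_eq (he : e ∈ C0) (h : modNorm e = 4) :
    Phi2 e = e.1 / (4 * Real.pi) * ellipticK (e.1 ^ 2 / 16) := by
  rw [Phi2, integral_bigLambda_of_modNorm_eq he h, wavelength, phiEll, h, phiM,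
    (modNorm_eq_four_iff he).1 h]
  have := Real.pi_ne_zero
  field_simp

/-- Four quadrants are folded onto one. For a function of `cos t`, pairing `t` with `t + π` removes
the part odd in the cosine. -/
theorem integral_two_pi_eq {f : ℝ → ℝ} (hf : Continuous f)
    (hs : ∀ t, f (Real.pi - t) = f (t + Real.pi)) (hs' : ∀ t, f (2 * Real.pi - t) = f t) :
    ∫ t in (0 : ℝ)..(2 * Real.pi), f t =
      2 * ∫ t in (0 : ℝ)..(Real.pi / 2), (f t + f (t + Real.pi)) := by
  have hf' : Continuous fun t => f (t + Real.pi) := by fun_prop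
  have h : ∫ t in (0 : ℝ)..Real.pi, f (t + Real.pi) = ∫ t in Real.pi..(2 * Real.pi), f t := by
    rw [intervalIntegral.integral_comp_add_right (fun t => f t)]
    congr 1 <;> ring
  rw [← intervalIntegral.integral_add_adjacent_intervals (hf.intervalIntegrable 0 Real.pi)
    (hf.intervalIntegrable _ _), ← h, ← intervalIntegral.integral_add
    (hf.intervalIntegrable _ _) (hf'.intervalIntegrable _ _),
    integral_zero_pi_of_pi_sub_eq (hf.fun_add hf'), ← intervalIntegral.integral_const_mul]
  refine intervalIntegral.integral_congr fun t _ => ?_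
  rw [hs, show Real.pi - t + Real.pi = 2 * Real.pi - t by ring, hs']
  ring

theorem phiR_pi_sub (e : ℝ × ℝ) (t : ℝ) : phiR e (Real.pi - t) = phiR e t := by
  simp [phiR, Real.cos_pi_sub]

theorem phiR_two_pi_sub (e : ℝ × ℝ) (t : ℝ) : phiR e (2 * Real.pi - t) = phiR e t := by
  simp [phiR, Real.cos_two_pi_sub]

theorem phiR_add_pi (e : ℝ × ℝ) (t : ℝ) : phiR e (t + Real.pi) = phiR e t := by
  simp [phiR, Real.cos_add_pi]

theorem lambdaCos_add_lambdaCos_neg (he : e ∈ C0) (h : modNorm e ≠ 4) (t : ℝ) :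
    lambdaCos e (Real.cos t) + lambdaCos e (-Real.cos t) =
      phiLambda e / 4 * (1 - (modNorm e ^ 2 + 16) * (modNorm e ^ 2 - 16) /
        ((modNorm e ^ 2 - 16) ^ 2 + 64 * e.1 ^ 2 * Real.sin t ^ 2)) := by
  have h1 := phiLambda_add_mul_cos_pos he h (Real.abs_cos_le_one t)
  have h2 := phiLambda_add_mul_cos_pos he h (x := -Real.cos t)
    (by rw [abs_neg]; exact Real.abs_cos_le_one t)
  have h3 : phiLambda e - 2 * e.1 * Real.cos t ≠ 0 := by linarith
  have h4 : phiLambda e - 2 * e.1 * -Real.cos t ≠ 0 := by linarith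
  -- The common denominator `λ² - 4e₁² cos² t` becomes, through `phiLambda_sq`, the denominator
  -- occurring in `Π`.
  have hQ : (modNorm e ^ 2 - 16) ^ 2 + 64 * e.1 ^ 2 * Real.sin t ^ 2 =
      16 * ((phiLambda e - 2 * e.1 * Real.cos t) * (phiLambda e - 2 * e.1 * -Real.cos t)) := by
    rw [modNorm_sq]
    linear_combination 64 * e.1 ^ 2 * Real.sin_sq_add_cos_sq t - phiLambda_sq e
  rw [lambdaCos, lambdaCos, hQ, modNorm_sq, div_add_div _ _ h3 h4, div_eq_iff (mul_ne_zero h3 h4)]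
  generalize hY : (e.1 ^ 2 + e.2 ^ 2 + 16) * (e.1 ^ 2 + e.2 ^ 2 - 16) /
    (16 * ((phiLambda e - 2 * e.1 * Real.cos t) * (phiLambda e - 2 * e.1 * -Real.cos t))) = Y
  rw [div_eq_iff (mul_ne_zero (by norm_num) (mul_ne_zero h3 h4))] at hY
  linear_combination (-phiLambda e / 64) * (hY + phiLambda_sq e)

theorem Phi2_eq_integral (he : e ∈ C0) (h : modNorm e ≠ 4) :
    Phi2 e = phiLambda e / (2 * Real.pi) * ∫ t in (0 : ℝ)..(Real.pi / 2),
      1 / phiR e t * (1 - (modNorm e ^ 2 + 16) * (modNorm e ^ 2 - 16) /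
        ((modNorm e ^ 2 - 16) ^ 2 + 64 * e.1 ^ 2 * Real.sin t ^ 2)) := by
  have hc := continuous_lambdaCos_cos he h
  have hcont : Continuous fun t => lambdaCos e (Real.cos t) * (2 / phiR e t) :=
    hc.mul (continuous_const.div (continuous_phiR e) fun t => (phiR_pos he t).ne')
  rw [Phi2, show bigLambda e = fun s => lambdaCos e (Real.cos (phiAngle e s)) from
    funext (bigLambda_eq e), integral_wavelength_eq he hc, integral_two_pi_eq hcont,
    ← mul_assoc, ← intervalIntegral.integral_const_mul, ← intervalIntegral.integral_const_mul]
  · refine intervalIntegral.integral_congr fun t _ => ?_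
    rw [phiR_add_pi, Real.cos_add_pi, ← add_mul, lambdaCos_add_lambdaCos_neg he h]
    have := (phiR_pos he t).ne'
    have := Real.pi_ne_zero
    field_simp
    ring
  · intro t
    rw [phiR_add_pi, phiR_pi_sub, Real.cos_add_pi, Real.cos_pi_sub]
  · intro t
    rw [phiR_two_pi_sub, Real.cos_two_pi_sub]

theorem Phi2_of_modNorm_ne (he : e ∈ C0) (h : modNorm e ≠ 4) :
    Phi2 e = phiLambda e / (2 * Real.pi * modNorm e) *
      (ellipticK (phiM e) - (modNorm e ^ 2 + 16) / (modNorm e ^ 2 - 16) *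
        ellipticPi (-64 * e.1 ^ 2 / (modNorm e ^ 2 - 16) ^ 2) (phiM e)) := by
  have hD : modNorm e ^ 2 - 16 ≠ 0 := fun h' => h (by nlinarith [modNorm_pos he])
  have hm := phiM_lt_one he
  have hQ : ∀ t, (modNorm e ^ 2 - 16) ^ 2 + 64 * e.1 ^ 2 * Real.sin t ^ 2 ≠ 0 := fun t => by
    positivity
  have hQ' : ∀ t, 1 - -64 * e.1 ^ 2 / (modNorm e ^ 2 - 16) ^ 2 * Real.sin t ^ 2 =
      ((modNorm e ^ 2 - 16) ^ 2 + 64 * e.1 ^ 2 * Real.sin t ^ 2) / (modNorm e ^ 2 - 16) ^ 2 :=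
    fun t => by field_simp; ring
  have hcont : Continuous fun t =>
      1 / ((1 - -64 * e.1 ^ 2 / (modNorm e ^ 2 - 16) ^ 2 * Real.sin t ^ 2) *
        ellipticDelta (phiM e) t) := by
    refine continuous_const.div (Continuous.mul (by fun_prop) (continuous_ellipticDelta _))
      fun t => mul_ne_zero ?_ (ellipticDelta_pos hm t).ne'
    rw [hQ']
    exact div_ne_zero (hQ t) (pow_ne_zero 2 hD)
  have hPi : ellipticPi (-64 * e.1 ^ 2 / (modNorm e ^ 2 - 16) ^ 2) (phiM e) =
      ∫ t in (0 : ℝ)..(Real.pi / 2),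
        1 / ((1 - -64 * e.1 ^ 2 / (modNorm e ^ 2 - 16) ^ 2 * Real.sin t ^ 2) *
          ellipticDelta (phiM e) t) := rfl
  rw [Phi2_eq_integral he h, ellipticK, ellipticF_eq, hPi, ← intervalIntegral.integral_const_mul,
    ← intervalIntegral.integral_const_mul, ← intervalIntegral.integral_sub
      ((continuous_one_div_ellipticDelta hm).intervalIntegrable _ _)
      ((continuous_const.fun_mul hcont).intervalIntegrable _ _),
    ← intervalIntegral.integral_const_mul]
  refine intervalIntegral.integral_congr fun t _ => ?_
  rw [hQ', ← modNorm_mul_ellipticDelta e he]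
  have := (modNorm_pos he).ne'
  have := (ellipticDelta_pos hm t).ne'
  have := hQ t
  have := Real.pi_ne_zero
  field_simp

end Quantum

/-! ### The regularized quantum -/

theorem integral_one_div_cos_sq_add_sin_sq {p q : ℝ} (hp : 0 < p) (hq : 0 < q) :
    ∫ t in (0 : ℝ)..(Real.pi / 2), 1 / (p ^ 2 * Real.cos t ^ 2 + q ^ 2 * Real.sin t ^ 2) =
      Real.pi / (2 * p * q) := by
  have hpos : ∀ {a b : ℝ}, 0 < a → 0 < b → ∀ t, 0 < a * Real.cos t ^ 2 + b * Real.sin t ^ 2 := by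
    intro a b ha hb t
    nlinarith [Real.sin_sq_add_cos_sq t, mul_pos ha hb, mul_nonneg ha.le (sq_nonneg (Real.cos t)),
      mul_nonneg hb.le (sq_nonneg (Real.sin t)), sq_nonneg (Real.cos t), sq_nonneg (Real.sin t),
      mul_nonneg (mul_nonneg ha.le hb.le) (sq_nonneg (Real.cos t)),
      mul_nonneg (mul_nonneg ha.le hb.le) (sq_nonneg (Real.sin t))]
  have hM := hpos hp hq
  have hQ := hpos (pow_pos hp 2) (pow_pos hq 2)
  -- The usual primitive `arctan((q/p) tan t)` is undefined at `π/2`. By the subtraction formula for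
  -- the tangent, its difference from `t` is the arctangent of a quotient with positive denominator,
  -- which vanishes at both endpoints.
  have hderiv : ∀ t, HasDerivAt (fun t => 1 / (p * q) * (t + Real.arctan ((q - p) *
      (Real.sin t * Real.cos t) / (p * Real.cos t ^ 2 + q * Real.sin t ^ 2))))
      (1 / (p ^ 2 * Real.cos t ^ 2 + q ^ 2 * Real.sin t ^ 2)) t := by
    intro t
    have hN := (((Real.hasDerivAt_sin t).fun_mul (Real.hasDerivAt_cos t)).const_mul (q - p))
    have hM' := (((Real.hasDerivAt_cos t).fun_pow 2).const_mul p).fun_add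
      (((Real.hasDerivAt_sin t).fun_pow 2).const_mul q)
    refine (((hasDerivAt_id t).add (hN.fun_div hM' (hM t).ne').arctan).const_mul
      (1 / (p * q))).congr_deriv ?_
    have h1 := Real.sin_sq_add_cos_sq t
    have hM0 := (hM t).ne'
    have hQ0 := (hQ t).ne'
    have hsum : 1 + ((q - p) * (Real.sin t * Real.cos t) /
        (p * Real.cos t ^ 2 + q * Real.sin t ^ 2)) ^ 2 =
        (p ^ 2 * Real.cos t ^ 2 + q ^ 2 * Real.sin t ^ 2) /
          (p * Real.cos t ^ 2 + q * Real.sin t ^ 2) ^ 2 := by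
      rw [eq_div_iff (pow_ne_zero 2 hM0), add_mul, div_pow, div_mul_cancel₀ _ (pow_ne_zero 2 hM0)]
      linear_combination (p ^ 2 * Real.cos t ^ 2 + q ^ 2 * Real.sin t ^ 2) * h1
    rw [hsum]
    have hnum : (q - p) * (Real.cos t * Real.cos t + Real.sin t * -Real.sin t) *
        (p * Real.cos t ^ 2 + q * Real.sin t ^ 2) - (q - p) * (Real.sin t * Real.cos t) *
        (p * (2 * Real.cos t * -Real.sin t) + q * (2 * Real.sin t * Real.cos t)) =
        p * q - (p ^ 2 * Real.cos t ^ 2 + q ^ 2 * Real.sin t ^ 2) := by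
      linear_combination ((q - p) * (p * Real.cos t ^ 2 - q * Real.sin t ^ 2) + p * q) * h1
    simp only [Nat.cast_ofNat, Nat.add_one_sub_one, pow_one]
    rw [hnum]
    have := hp.ne'
    have := hq.ne'
    field_simp
    ring
  have hcont : Continuous fun t =>
      1 / (p ^ 2 * Real.cos t ^ 2 + q ^ 2 * Real.sin t ^ 2) :=
    continuous_const.div (by fun_prop) fun t => (hQ t).ne'
  rw [intervalIntegral.integral_eq_sub_of_hasDerivAt (fun t _ => hderiv t)
    (hcont.intervalIntegrable _ _)]
  simp only [Real.sin_pi_div_two, Real.cos_pi_div_two, Real.sin_zero, mul_zero, zero_mul,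
    zero_div, Real.arctan_zero, add_zero]
  field_simp
  ring

/-! ### Separation of the jump of `Φ₂` from its analytic part. -/

section Regularization

variable {e : ℝ × ℝ}

/-- The integrand of the regularized quantum. -/
noncomputable def phiRegIntegrand (e : ℝ × ℝ) (t : ℝ) : ℝ :=
  (phiR e t + 4) / (phiR e t * (8 * phiR e t + (e.1 ^ 2 + e.2 ^ 2 + 16)))

theorem phiRegIntegrand_denom_pos (he : e ∈ C0) (t : ℝ) :
    0 < phiR e t * (8 * phiR e t + (e.1 ^ 2 + e.2 ^ 2 + 16)) := by
  have := phiR_pos he t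
  positivity

theorem continuous_phiRegIntegrand (he : e ∈ C0) : Continuous (phiRegIntegrand e) := by
  have := continuous_phiR e
  exact Continuous.div (by fun_prop) (by fun_prop) fun t => (phiRegIntegrand_denom_pos he t).ne'

/-- With `M = |e|²` and `R = phiR e t`, the denominator is `(M + 16)² - 64R²`, and only the factor
`M + 16 - 8R` can degenerate as `|e| → 4`. Partial fractions leave `8R + M + 16` in the regular part
and put the rest into an integrand with elementary integral. -/
theorem phiQuantum_integrand_eq (he : e ∈ C0) (h : modNorm e ≠ 4) (t : ℝ) :
    1 / phiR e t * (1 - (modNorm e ^ 2 + 16) * (modNorm e ^ 2 - 16) /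
        ((modNorm e ^ 2 - 16) ^ 2 + 64 * e.1 ^ 2 * Real.sin t ^ 2)) =
      8 * phiRegIntegrand e t - 8 * (modNorm e ^ 2 - 16) *
        (1 / (|modNorm e ^ 2 - 16| ^ 2 * Real.cos t ^ 2 +
          (4 * phiLambda e) ^ 2 * Real.sin t ^ 2)) := by
  have hD : modNorm e ^ 2 - 16 ≠ 0 := fun h' => h (by nlinarith [modNorm_pos he])
  have hQ : |modNorm e ^ 2 - 16| ^ 2 * Real.cos t ^ 2 + (4 * phiLambda e) ^ 2 * Real.sin t ^ 2 =
      (modNorm e ^ 2 - 16) ^ 2 + 64 * e.1 ^ 2 * Real.sin t ^ 2 := by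
    rw [sq_abs, modNorm_sq]
    linear_combination Real.sin t ^ 2 * phiLambda_sq e +
      (e.1 ^ 2 + e.2 ^ 2 - 16) ^ 2 * Real.sin_sq_add_cos_sq t
  have hR := phiR_pos he t
  have hB : 0 < 8 * phiR e t + (modNorm e ^ 2 + 16) := by positivity
  have hQ' : (modNorm e ^ 2 - 16) ^ 2 + 64 * e.1 ^ 2 * Real.sin t ^ 2 =
      (modNorm e ^ 2 + 16 - 8 * phiR e t) * (8 * phiR e t + (modNorm e ^ 2 + 16)) := by
    have h1 := phiR_sq e t
    rw [modNorm_sq]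
    linear_combination 64 * h1 + 64 * e.1 ^ 2 * Real.sin_sq_add_cos_sq t
  have hQ0 : (modNorm e ^ 2 - 16) ^ 2 + 64 * e.1 ^ 2 * Real.sin t ^ 2 ≠ 0 := by positivity
  have hA : modNorm e ^ 2 + 16 - 8 * phiR e t ≠ 0 := fun h0 => hQ0 (by rw [hQ', h0, zero_mul])
  rw [hQ, hQ', phiRegIntegrand, ← modNorm_sq]
  have hR0 := hR.ne'
  have hB0 := hB.ne'
  clear hQ hQ' hQ0 hB hD hR
  generalize modNorm e ^ 2 = M at *
  generalize phiR e t = R at *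
  generalize hS : M + 16 - 8 * R = S at *
  generalize hT : 8 * R + (M + 16) = T at *
  obtain rfl : M = T - 8 * R - 16 := by linarith
  have hTS : T = S + 16 * R := by linarith
  field_simp
  rw [hTS]
  ring

theorem Phi2Reg_eq_integral (he : e ∈ C0) :
    Phi2Reg e = 1 / 2 + 4 * phiLambda e / Real.pi *
      ∫ t in (0 : ℝ)..(Real.pi / 2), phiRegIntegrand e t := by
  have hl := phiLambda_pos he
  have hpi := Real.pi_ne_zero
  by_cases h : modNorm e = 4
  · have h16 := (modNorm_eq_four_iff he).1 h
    rw [Phi2Reg, if_neg (by rw [h]; exact lt_irrefl _), if_pos h, Phi2_of_modNorm_eq he h,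
      add_comm, ellipticK, ellipticF_eq, phiLambda_eq_of_modNorm_eq he h,
      ← intervalIntegral.integral_const_mul, ← intervalIntegral.integral_const_mul]
    congr 1
    refine intervalIntegral.integral_congr fun t _ => ?_
    have hm : e.1 ^ 2 / 16 = phiM e := by rw [phiM, h16]
    have hR := (phiR_pos he t)
    have hd : ellipticDelta (phiM e) t = phiR e t / 4 := by
      rw [← modNorm_mul_ellipticDelta e he, h]; ring
    rw [hm, hd, phiRegIntegrand, h16]
    field_simp
    ring
  · have hD : modNorm e ^ 2 - 16 ≠ 0 := fun h' => h (by nlinarith [modNorm_pos he])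
    have hDpos := abs_pos.2 hD
    have hcont : Continuous fun t => 1 / (|modNorm e ^ 2 - 16| ^ 2 * Real.cos t ^ 2 +
          (4 * phiLambda e) ^ 2 * Real.sin t ^ 2) := by
      refine continuous_const.div (by fun_prop) fun t => ?_
      rcases eq_or_ne (Real.cos t) 0 with hc | hc
      · have := Real.sin_sq_add_cos_sq t
        rw [hc] at this ⊢
        have hs : Real.sin t ^ 2 = 1 := by linarith
        rw [hs]
        positivity
      · positivity
    -- The coefficient `|e|² - 16` cancels against the `1/| |e|² - 16 |` of the elementary integral,
    -- so only its sign survives.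
    have key : Phi2 e = 4 * phiLambda e / Real.pi *
        (∫ t in (0 : ℝ)..(Real.pi / 2), phiRegIntegrand e t) -
          (modNorm e ^ 2 - 16) / |modNorm e ^ 2 - 16| / 2 := by
      rw [Phi2_eq_integral he h]
      simp only [phiQuantum_integrand_eq he h]
      rw [intervalIntegral.integral_sub
        (((continuous_phiRegIntegrand he).const_mul 8).intervalIntegrable _ _)
        ((hcont.const_mul _).intervalIntegrable _ _), intervalIntegral.integral_const_mul,
        intervalIntegral.integral_const_mul,
        integral_one_div_cos_sq_add_sin_sq hDpos (by positivity)]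
      have := hDpos.ne'
      field_simp
      ring
    rw [Phi2Reg, if_neg h, key]
    rcases lt_or_gt_of_ne h with hlt | hgt
    · have : modNorm e ^ 2 - 16 < 0 := by nlinarith [modNorm_pos he]
      rw [if_pos hlt, abs_of_neg this, div_neg, div_self hD]
      ring
    · have : 0 < modNorm e ^ 2 - 16 := by nlinarith [modNorm_pos he]
      rw [if_neg hgt.not_gt, abs_of_pos this, div_self hD]
      ring

end Regularization

/-! ### Analyticity -/

open scoped Topology

/-- The square root of a continuous function. -/
noncomputable def continuousMapSqrt {K : Type*} [TopologicalSpace K] (x : C(K, ℝ)) : C(K, ℝ) :=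
  (⟨Real.sqrt, Real.continuous_sqrt⟩ : C(ℝ, ℝ)).comp x

/-- The analytic inverse function theorem is applied to squaring in `C(K, ℝ)`: its derivative at `x
= √y` is multiplication by `2x`, invertible because `x > 0`. -/
theorem analyticAt_continuousMapSqrt {K : Type*} [TopologicalSpace K] [CompactSpace K]
    {y : C(K, ℝ)} (hy : ∀ t, 0 < y t) : AnalyticAt ℝ continuousMapSqrt y := by
  set x : C(K, ℝ) := continuousMapSqrt y with hx
  have hxx : x * x = y := by ext t; exact Real.mul_self_sqrt (hy t).le
  have hxpos : ∀ t, 0 < x t := fun t => Real.sqrt_pos.2 (hy t)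
  let z : C(K, ℝ) := ⟨fun t => (2 * x t)⁻¹, (by fun_prop : Continuous fun t => 2 * x t).inv₀
    fun t => (mul_pos two_pos (hxpos t)).ne'⟩
  have hz : ∀ t, 2 * x t * z t = 1 := fun t =>
    mul_inv_cancel₀ (mul_pos two_pos (hxpos t)).ne'
  let i : C(K, ℝ) ≃L[ℝ] C(K, ℝ) := ContinuousLinearEquiv.equivOfInverse
    (ContinuousLinearMap.mul ℝ _ (x + x)) (ContinuousLinearMap.mul ℝ _ z)
    (fun w => by
      ext t
      have := hz t
      simp only [ContinuousLinearMap.mul_apply', ContinuousMap.mul_apply, ContinuousMap.add_apply]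
      linear_combination w t * this)
    (fun w => by
      ext t
      have := hz t
      simp only [ContinuousLinearMap.mul_apply', ContinuousMap.mul_apply, ContinuousMap.add_apply]
      linear_combination w t * this)
  have hd : HasStrictFDerivAt (fun w : C(K, ℝ) => w * w) (i : C(K, ℝ) →L[ℝ] C(K, ℝ)) x := by
    refine ((hasStrictFDerivAt_id x).fun_mul (hasStrictFDerivAt_id x)).congr_fderiv ?_
    ext w t
    simp [i]
  let R := hd.toOpenPartialHomeomorph _
  have hxR : x ∈ R.source := hd.mem_toOpenPartialHomeomorph_source
  have hana : AnalyticAt ℝ R.symm (R x) := by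
    refine R.analyticAt_symm' hxR (i := i) ?_ hd.hasFDerivAt.fderiv
    exact analyticAt_id.mul analyticAt_id
  have hRx : R x = y := hxx
  rw [hRx] at hana
  refine hana.congr ?_
  have hcont : Continuous (continuousMapSqrt (K := K)) := ContinuousMap.continuous_postcomp _
  -- Near `y` the pointwise root lies in the domain of the local homeomorphism and squares back to
  -- `w`, so it is the local inverse.
  have h1 : ∀ᶠ w in 𝓝 y, continuousMapSqrt w ∈ R.source :=
    hcont.continuousAt.eventually (R.open_source.mem_nhds hxR)
  have h2 : ∀ᶠ w : C(K, ℝ) in 𝓝 y, Set.MapsTo w Set.univ (Set.Ioi 0) :=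
    (ContinuousMap.isOpen_setOfPred_mapsTo isCompact_univ isOpen_Ioi).mem_nhds fun t _ => hy t
  filter_upwards [h1, h2] with w hw1 hw2
  have hRw : R (continuousMapSqrt w) = w := by
    ext t
    exact Real.mul_self_sqrt (le_of_lt (hw2 (Set.mem_univ t)))
  conv_lhs => rw [← hRw]
  exact R.left_inv hw1

/-- Integration over `[0, π/2]` as a continuous linear functional on continuous functions. -/
noncomputable def integralHalfPi : C(Set.Icc (0 : ℝ) (Real.pi / 2), ℝ) →L[ℝ] ℝ :=
  have h0 : (0 : ℝ) ≤ Real.pi / 2 := by positivity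
  have hc : ∀ f : C(Set.Icc (0 : ℝ) (Real.pi / 2), ℝ),
      Continuous fun t => f (Set.projIcc 0 (Real.pi / 2) h0 t) := fun f =>
    f.continuous.comp continuous_projIcc
  LinearMap.mkContinuous
    { toFun := fun f => ∫ t in (0 : ℝ)..(Real.pi / 2), f (Set.projIcc 0 (Real.pi / 2) h0 t)
      map_add' := fun f g => intervalIntegral.integral_add ((hc f).intervalIntegrable _ _)
        ((hc g).intervalIntegrable _ _)
      map_smul' := fun r f => intervalIntegral.integral_const_mul r _ }
    (Real.pi / 2) fun f => by
      have := intervalIntegral.norm_integral_le_of_norm_le_const (a := 0) (b := Real.pi / 2)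
        (f := fun t => f (Set.projIcc 0 (Real.pi / 2) h0 t)) (C := ‖f‖)
        fun t _ => f.norm_coe_le_norm _
      rw [sub_zero, abs_of_nonneg h0, mul_comm] at this
      exact this

theorem integralHalfPi_apply (f : C(Set.Icc (0 : ℝ) (Real.pi / 2), ℝ)) {g : ℝ → ℝ}
    (h : ∀ t, f t = g t) : integralHalfPi f = ∫ t in (0 : ℝ)..(Real.pi / 2), g t := by
  have h0 : (0 : ℝ) ≤ Real.pi / 2 := by positivity
  refine intervalIntegral.integral_congr fun t ht => ?_
  rw [Set.uIcc_of_le h0] at ht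
  rw [h, Set.projIcc_of_mem h0 ht]

theorem analyticAt_ringInverse_of_ne_zero {K : Type*} [TopologicalSpace K] [CompactSpace K]
    {x : C(K, ℝ)} (hx : ∀ t, x t ≠ 0) : AnalyticAt ℝ (Ring.inverse : C(K, ℝ) → C(K, ℝ)) x := by
  obtain ⟨u, rfl⟩ := (ContinuousMap.isUnit_iff_forall_ne_zero x).2 hx
  exact analyticAt_inverse u

theorem ringInverse_continuousMap_apply {K : Type*} [TopologicalSpace K] {x : C(K, ℝ)}
    (hx : ∀ t, x t ≠ 0) (t : K) : (Ring.inverse x : C(K, ℝ)) t = (x t)⁻¹ := by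
  have h := congrArg (fun f : C(K, ℝ) => f t)
    (Ring.inverse_mul_cancel x ((ContinuousMap.isUnit_iff_forall_ne_zero x).2 hx))
  exact eq_inv_of_mul_eq_one_left h

theorem isOpen_C0 : IsOpen C0 :=
  (isOpen_lt continuous_const continuous_fst).inter (isOpen_lt continuous_const continuous_snd)

theorem analyticAt_integral_phiRegIntegrand {e : ℝ × ℝ} (he : e ∈ C0) :
    AnalyticAt ℝ (fun e => ∫ t in (0 : ℝ)..(Real.pi / 2), phiRegIntegrand e t) e := by
  let c : C(Set.Icc (0 : ℝ) (Real.pi / 2), ℝ) := ⟨fun t => Real.cos t ^ 2, by fun_prop⟩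
  let A : ℝ × ℝ → C(Set.Icc (0 : ℝ) (Real.pi / 2), ℝ) := fun e =>
    e.2 ^ 2 • (1 : C(Set.Icc (0 : ℝ) (Real.pi / 2), ℝ)) + e.1 ^ 2 • c
  let R : ℝ × ℝ → C(Set.Icc (0 : ℝ) (Real.pi / 2), ℝ) := fun e => continuousMapSqrt (A e)
  have hAt : ∀ e t, A e t = e.2 ^ 2 + e.1 ^ 2 * Real.cos t ^ 2 := fun e t => by simp [A, c]
  have hRt : ∀ e t, R e t = phiR e t := fun e t => congrArg Real.sqrt (hAt e t)
  have hA : AnalyticAt ℝ A e :=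
    ((analyticAt_snd.pow 2).smul analyticAt_const).add
      ((analyticAt_fst.pow 2).smul analyticAt_const)
  have hR : AnalyticAt ℝ R e := by
    refine AnalyticAt.comp (analyticAt_continuousMapSqrt fun t => ?_) hA
    rw [hAt]
    have := he.2
    positivity
  let B : ℝ × ℝ → C(Set.Icc (0 : ℝ) (Real.pi / 2), ℝ) := fun e =>
    R e * ((8 : ℝ) • R e + (e.1 ^ 2 + e.2 ^ 2 + 16) • 1)
  have hBt : ∀ e t, B e t = phiR e t * (8 * phiR e t + (e.1 ^ 2 + e.2 ^ 2 + 16)) := fun e t => by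
    simp [B, hRt]
  have hB : AnalyticAt ℝ B e :=
    hR.fun_mul ((analyticAt_const.fun_smul hR).fun_add ((((analyticAt_fst.fun_pow 2).fun_add
      (analyticAt_snd.fun_pow 2)).fun_add analyticAt_const).fun_smul analyticAt_const))
  have hB0 : ∀ {e}, e ∈ C0 → ∀ t, B e t ≠ 0 := fun he t => by
    rw [hBt]; exact (phiRegIntegrand_denom_pos he t).ne'
  have hinv : AnalyticAt ℝ (fun e => Ring.inverse (B e)) e :=
    AnalyticAt.comp (analyticAt_ringInverse_of_ne_zero (hB0 he)) hB
  have htot : AnalyticAt ℝ (fun e => integralHalfPi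
      ((R e + (4 : ℝ) • 1) * Ring.inverse (B e))) e :=
    (integralHalfPi.analyticAt _).comp ((hR.add analyticAt_const).mul hinv)
  refine htot.congr ?_
  -- `Ring.inverse` is the pointwise inverse only where `B e'` has no zero, which holds on the open
  -- set `C0`.
  filter_upwards [isOpen_C0.mem_nhds he] with e' he'
  refine integralHalfPi_apply _ fun t => ?_
  rw [ContinuousMap.mul_apply, ringInverse_continuousMap_apply (hB0 he'), hBt, phiRegIntegrand,
    div_eq_mul_inv (phiR e' t + 4)]
  simp [hRt]

theorem analyticAt_phiLambda {e : ℝ × ℝ} (he : e ∈ C0) : AnalyticAt ℝ phiLambda e := by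
  have h : phiLambda = fun e => 1 / 4 *
      Real.sqrt ((e.1 ^ 2 + e.2 ^ 2 - 16) ^ 2 + 64 * e.1 ^ 2) := by
    funext e
    rw [← phiLambda_sq, show 16 * phiLambda e ^ 2 = (4 * phiLambda e) ^ 2 by ring, Real.sqrt_sq]
    · ring
    · unfold phiLambda momentumEigenvalue; positivity
  have hne : (e.1 ^ 2 + e.2 ^ 2 - 16) ^ 2 + 64 * e.1 ^ 2 ≠ 0 := by
    have := he.1
    positivity
  rw [h]
  refine analyticAt_const.mul (AnalyticAt.comp (g := Real.sqrt)
    (f := fun e : ℝ × ℝ => (e.1 ^ 2 + e.2 ^ 2 - 16) ^ 2 + 64 * e.1 ^ 2)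
    (Real.contDiffAt_sqrt hne).analyticAt ?_)
  exact (((((analyticAt_fst.pow 2).add (analyticAt_snd.pow 2)).sub analyticAt_const).pow 2).add
    (analyticAt_const.mul (analyticAt_fst.pow 2)))

theorem analyticOnNhd_Phi2Reg : AnalyticOnNhd ℝ Phi2Reg C0 := by
  intro e he
  have h : AnalyticAt ℝ (fun e => 1 / 2 + 4 * phiLambda e / Real.pi *
      ∫ t in (0 : ℝ)..(Real.pi / 2), phiRegIntegrand e t) e :=
    analyticAt_const.add (((analyticAt_const.mul (analyticAt_phiLambda he)).div analyticAt_const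
      Real.pi_ne_zero).mul (analyticAt_integral_phiRegIntegrand he))
  refine h.congr ?_
  filter_upwards [isOpen_C0.mem_nhds he] with e' he'
  exact (Phi2Reg_eq_integral he').symm

/-! ### Legendrian frames -/

open Complex ComplexConjugate

section Frame

/-- `(p, p')` solves the scalar Legendrian frame equation `p'' = -p + i k p'`. -/
def IsFrameSolution (k : ℝ → ℝ) (p q : ℝ → ℂ) : Prop :=
  ∀ s, HasDerivAt p (q s) s ∧ HasDerivAt q (-p s + k s * I * q s) s

variable {k : ℝ → ℝ} {p q P Q : ℝ → ℂ}

theorem _root_.HasDerivAt.complexConj {f : ℝ → ℂ} {f' : ℂ} {s : ℝ} (h : HasDerivAt f f' s) :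
    HasDerivAt (fun s => conj (f s)) (conj f') s :=
  h.star

theorem IsFrameSolution.comp_sub_const (h : IsFrameSolution k p q) (a : ℝ) :
    IsFrameSolution (fun s => k (s - a)) (fun s => p (s - a)) fun s => q (s - a) := fun s =>
  ⟨(h (s - a)).1.comp_sub_const s a, (h (s - a)).2.comp_sub_const s a⟩

/-- The matrix `[[0, 1], [-1, i k]]` of the first-order system is skew-Hermitian, so the Hermitian
product of two solutions is conserved. -/
theorem IsFrameSolution.pairing_const (h : IsFrameSolution k p q) (H : IsFrameSolution k P Q)
    (s t : ℝ) : p s * conj (P s) + q s * conj (Q s) = p t * conj (P t) + q t * conj (Q t) := by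
  have hd : ∀ s, HasDerivAt (fun s => p s * conj (P s) + q s * conj (Q s)) 0 s := fun s => by
    refine (((h s).1.fun_mul (H s).1.complexConj).fun_add
      ((h s).2.fun_mul (H s).2.complexConj)).congr_deriv ?_
    simp only [map_add, map_neg, map_mul, conj_ofReal, conj_I]
    ring
  exact is_const_of_deriv_eq_zero (fun s => (hd s).differentiableAt) (fun s => (hd s).deriv) s t

/-- The second solution obtained from the quaternionic structure of `ℂ²`. -/
theorem IsFrameSolution.conj_solution (h : IsFrameSolution k p q) {κ : ℝ → ℝ}
    (hκ : ∀ s, HasDerivAt κ (k s) s) :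
    IsFrameSolution k (fun s => -(cexp (κ s * I) * conj (q s)))
      fun s => cexp (κ s * I) * conj (p s) := fun s => by
  have hE : HasDerivAt (fun s => cexp (κ s * I)) (cexp (κ s * I) * (k s * I)) s :=
    ((hκ s).ofReal_comp.mul_const I).cexp
  constructor
  · refine (hE.fun_mul (h s).2.complexConj).fun_neg.congr_deriv ?_
    simp only [map_add, map_neg, map_mul, conj_ofReal, conj_I]
    ring
  · refine (hE.fun_mul (h s).1.complexConj).congr_deriv ?_
    ring

/-- If one nonzero solution and its derivative are `T`-periodic, and `∫ k` is `T`-periodic, then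
all solutions are `T`-periodic. -/
theorem IsFrameSolution.periodic_of_periodic (h : IsFrameSolution k p q)
    (hne : ∃ s, p s ≠ 0) {κ : ℝ → ℝ} (hκ : ∀ s, HasDerivAt κ (k s) s) {T : ℝ}
    (hp : Function.Periodic p T) (hq : Function.Periodic q T) (hκT : Function.Periodic κ T)
    {g t : ℝ → ℂ} (H : IsFrameSolution k g t) : Function.Periodic g T := by
  obtain ⟨s₁, hs₁⟩ := hne
  have h2 := h.conj_solution hκ
  have hN := h.pairing_const h
  set N : ℂ := p s₁ * conj (p s₁) + q s₁ * conj (q s₁) with hNdef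
  have hN0 : N ≠ 0 := by
    rw [hNdef, mul_conj, mul_conj, ← ofReal_add]
    have := normSq_pos.2 hs₁
    have := normSq_nonneg (q s₁)
    exact ofReal_ne_zero.2 (by linarith)
  have hEE : ∀ s, cexp (κ s * I) * conj (cexp (κ s * I)) = 1 := fun s => by
    rw [mul_conj, normSq_eq_norm_sq, norm_exp_ofReal_mul_I]; simp
  have hA := H.pairing_const h
  have hB := H.pairing_const h2
  -- The vector `(p, q)` and its conjugate solution are orthogonal with the same squared norm `N`,
  -- so `(g, t)` expands in them with constant coefficients.
  have key : ∀ s, N * g s = (g 0 * conj (p 0) + t 0 * conj (q 0)) * p s +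
      (g 0 * conj (-(cexp (κ 0 * I) * conj (q 0))) +
        t 0 * conj (cexp (κ 0 * I) * conj (p 0))) * -(cexp (κ s * I) * conj (q s)) := fun s => by
    rw [hA 0 s, hB 0 s, hNdef, hN s₁ s]
    simp only [map_neg, map_mul, conj_conj]
    linear_combination (-g s * q s * conj (q s) + t s * p s * conj (q s)) * hEE s
  intro s
  refine mul_left_cancel₀ hN0 ?_
  rw [key, key, hp, hq, hκT]

end Frame

/-! ### The moving frame of a Legendrian curve and its determinant. -/

section Legendrian

variable {γ : ℝ → C2}

theorem IsUnitSpeedLegendrian.contDiff_deriv (h : IsUnitSpeedLegendrian γ) :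
    ContDiff ℝ ∞ (deriv γ) := (contDiff_infty_iff_deriv.1 h.smooth).2

theorem IsUnitSpeedLegendrian.hasDerivAt (h : IsUnitSpeedLegendrian γ) (s : ℝ) :
    HasDerivAt γ (deriv γ s) s := ((contDiff_infty_iff_deriv.1 h.smooth).1 s).hasDerivAt

theorem IsUnitSpeedLegendrian.hasDerivAt_deriv (h : IsUnitSpeedLegendrian γ) (s : ℝ) :
    HasDerivAt (deriv γ) (deriv (deriv γ) s) s :=
  ((contDiff_infty_iff_deriv.1 h.contDiff_deriv).1 s).hasDerivAt

theorem IsUnitSpeedLegendrian.contDiff_curvature (h : IsUnitSpeedLegendrian γ) :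
    ContDiff ℝ ∞ (curvature γ) :=
  Complex.imCLM.contDiff.comp
    (h.contDiff_deriv.inner ℂ (contDiff_infty_iff_deriv.1 h.contDiff_deriv).2)

theorem inner_C2 (v w : C2) : inner ℂ v w = conj (v 0) * w 0 + conj (v 1) * w 1 := by
  simp [PiLp.inner_apply, Fin.sum_univ_two, mul_comm]

theorem IsUnitSpeedLegendrian.inner_deriv_deriv (h : IsUnitSpeedLegendrian γ) (s : ℝ) :
    inner ℂ (γ s) (deriv (deriv γ) s) = -1 := by
  have h1 := (h.hasDerivAt s).inner ℂ (h.hasDerivAt_deriv s)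
  rw [show (fun t => inner ℂ (γ t) (deriv γ t)) = fun _ => (0 : ℂ) from funext h.legendrian] at h1
  have h2 := h1.unique (hasDerivAt_const s (0 : ℂ))
  rw [h.unit_speed] at h2
  exact eq_neg_of_add_eq_zero_left h2

theorem IsUnitSpeedLegendrian.inner_deriv_deriv_deriv (h : IsUnitSpeedLegendrian γ) (s : ℝ) :
    inner ℂ (deriv γ s) (deriv (deriv γ) s) = curvature γ s * I := by
  have h1 := (h.hasDerivAt_deriv s).inner ℂ (h.hasDerivAt_deriv s)
  rw [show (fun t => inner ℂ (deriv γ t) (deriv γ t)) = fun _ => (1 : ℂ) from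
    funext h.unit_speed] at h1
  have h2 := congrArg re (h1.unique (hasDerivAt_const s (1 : ℂ)))
  rw [← inner_conj_symm (deriv (deriv γ) s) (deriv γ s)] at h2
  simp only [add_re, conj_re, zero_re] at h2
  apply Complex.ext
  · simp only [mul_re, ofReal_re, I_re, mul_zero, ofReal_im, zero_mul, sub_zero]
    linarith
  · simp [curvature]

/-- The determinant of the frame `(γ, γ')`. -/
noncomputable def frameDet (γ : ℝ → C2) (s : ℝ) : ℂ :=
  γ s 0 * deriv γ s 1 - γ s 1 * deriv γ s 0

/-- Orthogonality to `γ` makes `γ'` a multiple of `γ*`; the factor, which is `e^{iθ}` in the Maslov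
index, is the frame determinant. -/
theorem IsUnitSpeedLegendrian.deriv_eq_frameDet_smul (h : IsUnitSpeedLegendrian γ) (s : ℝ) :
    deriv γ s = frameDet γ s • starVec (γ s) := by
  have h1 := h.mem_sphere s
  have h2 := h.legendrian s
  rw [inner_C2] at h1 h2
  ext j
  fin_cases j
  · simp [frameDet, starVec]
    linear_combination (-deriv γ s 0) * h1 + γ s 0 * h2
  · simp [frameDet, starVec]
    linear_combination (-deriv γ s 1) * h1 + γ s 1 * h2

theorem IsUnitSpeedLegendrian.frameDet_mul_conj (h : IsUnitSpeedLegendrian γ) (s : ℝ) :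
    frameDet γ s * conj (frameDet γ s) = 1 := by
  have h1 := h.mem_sphere s
  have h2 := h.legendrian s
  have h3 := h.unit_speed s
  have h4 := congrArg conj h2
  rw [inner_C2] at h1 h2 h3 h4
  simp only [map_add, map_mul, conj_conj, map_zero] at h4
  simp only [frameDet, map_sub, map_mul]
  linear_combination (conj (deriv γ s 0) * deriv γ s 0 + conj (deriv γ s 1) * deriv γ s 1) * h1 +
    h3 - (γ s 0 * conj (deriv γ s 0) + γ s 1 * conj (deriv γ s 1)) * h2

theorem IsUnitSpeedLegendrian.deriv_deriv_apply (h : IsUnitSpeedLegendrian γ) (s : ℝ) (j : Fin 2) :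
    deriv (deriv γ) s j = -γ s j + curvature γ s * I * deriv γ s j := by
  have e1 := h.inner_deriv_deriv s
  have e2 := h.inner_deriv_deriv_deriv s
  have h1 := h.mem_sphere s
  have h2 := h.legendrian s
  have h3 := h.unit_speed s
  have h4 := congrArg conj h2
  have hd := h.frameDet_mul_conj s
  have hd0 : conj (frameDet γ s) ≠ 0 := fun h0 => by simp [h0] at hd
  rw [inner_C2] at e1 e2 h1 h2 h3 h4
  simp only [map_add, map_mul, conj_conj, map_zero] at h4
  -- `γ'' + γ - i k γ'` is orthogonal to both `γ` and `γ'`. Multiplying by the conjugate determinant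
  -- solves these two equations by Cramer's rule.
  refine mul_left_cancel₀ hd0 ?_
  simp only [frameDet, map_sub, map_mul]
  fin_cases j
  · simp only [Fin.zero_eta, Fin.isValue]
    linear_combination conj (deriv γ s 1) * (e1 + h1 - curvature γ s * I * h2) -
      conj (γ s 1) * (e2 + h4 - curvature γ s * I * h3)
  · simp only [Fin.mk_one, Fin.isValue]
    linear_combination conj (γ s 0) * (e2 + h4 - curvature γ s * I * h3) -
      conj (deriv γ s 0) * (e1 + h1 - curvature γ s * I * h2)

theorem hasDerivAt_C2_apply {f : ℝ → C2} {f' : C2} {s : ℝ} (h : HasDerivAt f f' s) (j : Fin 2) :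
    HasDerivAt (fun s => f s j) (f' j) s :=
  ((EuclideanSpace.proj (𝕜 := ℂ) (ι := Fin 2) j).restrictScalars
    ℝ).hasFDerivAt.comp_hasDerivAt s h

theorem IsUnitSpeedLegendrian.isFrameSolution (h : IsUnitSpeedLegendrian γ) (j : Fin 2) :
    IsFrameSolution (curvature γ) (fun s => γ s j) fun s => deriv γ s j := fun s =>
  ⟨hasDerivAt_C2_apply (h.hasDerivAt s) j,
    h.deriv_deriv_apply s j ▸ hasDerivAt_C2_apply (h.hasDerivAt_deriv s) j⟩

/-- A solution of the frame equation is a combination of the components of the curve. -/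
theorem IsUnitSpeedLegendrian.frameSolution_eq (h : IsUnitSpeedLegendrian γ) {p q : ℝ → ℂ}
    (H : IsFrameSolution (curvature γ) p q) :
    ∃ w₀ w₁ : ℂ, ∀ s, p s = w₀ * γ s 0 + w₁ * γ s 1 := by
  refine ⟨p 0 * conj (γ 0 0) + q 0 * conj (deriv γ 0 0),
    p 0 * conj (γ 0 1) + q 0 * conj (deriv γ 0 1), fun s => ?_⟩
  rw [H.pairing_const (h.isFrameSolution 0) 0 s, H.pairing_const (h.isFrameSolution 1) 0 s]
  have h1 := h.mem_sphere s
  have h4 := congrArg conj (h.legendrian s)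
  rw [inner_C2] at h1 h4
  simp only [map_add, map_mul, conj_conj, map_zero] at h4
  linear_combination (-p s) * h1 - q s * h4

/-- Liouville's formula: the trace of the frame system is `i k`. -/
theorem IsUnitSpeedLegendrian.hasDerivAt_frameDet (h : IsUnitSpeedLegendrian γ) (s : ℝ) :
    HasDerivAt (frameDet γ) (curvature γ s * I * frameDet γ s) s := by
  have h0 := h.isFrameSolution 0 s
  have h1 := h.isFrameSolution 1 s
  refine ((h0.1.fun_mul h1.2).fun_sub (h1.1.fun_mul h0.2)).congr_deriv ?_
  rw [frameDet]
  ring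

theorem IsUnitSpeedLegendrian.frameDet_eq (h : IsUnitSpeedLegendrian γ) {κ : ℝ → ℝ}
    (hκ : ∀ s, HasDerivAt κ (curvature γ s) s) :
    ∃ c : ℝ, ∀ s, frameDet γ s = cexp ((c + κ s : ℝ) * I) := by
  have hd : ∀ s, HasDerivAt (fun s => frameDet γ s * cexp (-(κ s * I))) 0 s := fun s => by
    have hE : HasDerivAt (fun s => cexp (-(κ s * I)))
        (cexp (-(κ s * I)) * -(curvature γ s * I)) s :=
      ((hκ s).ofReal_comp.mul_const I).fun_neg.cexp
    refine ((h.hasDerivAt_frameDet s).fun_mul hE).congr_deriv ?_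
    ring
  have hconst := is_const_of_deriv_eq_zero (fun s => (hd s).differentiableAt)
    fun s => (hd s).deriv
  set d : ℂ := frameDet γ 0 * cexp (-(κ 0 * I)) with hdd
  have hn : ‖d‖ = 1 := by
    have h1 := h.frameDet_mul_conj 0
    rw [mul_conj, normSq_eq_norm_sq] at h1
    have h2 : ‖frameDet γ 0‖ ^ 2 = 1 := by exact_mod_cast h1
    have h3 : ‖frameDet γ 0‖ = 1 := by nlinarith [norm_nonneg (frameDet γ 0)]
    rw [hdd, norm_mul, h3, ← neg_mul, ← ofReal_neg, norm_exp_ofReal_mul_I, one_mul]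
  refine ⟨d.arg, fun s => ?_⟩
  have h1 : cexp (d.arg * I) = d := by
    have := norm_mul_exp_arg_mul_I d
    rwa [hn, ofReal_one, one_mul] at this
  rw [ofReal_add, add_mul, exp_add, h1, hdd, ← hconst s 0, mul_assoc, ← exp_add, neg_add_cancel,
    exp_zero, mul_one]

/-- Two continuous lifts differ by a continuous function with values in `2πℤ`, hence by a constant.
-/
theorem eq_of_cexp_mul_I_eq {f g : ℝ → ℝ} (hf : Continuous f) (hg : Continuous g)
    (h : ∀ s, cexp (f s * I) = cexp (g s * I)) (s t : ℝ) : f s - g s = f t - g t := by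
  have hn : ∀ s, ∃ n : ℤ, f s - g s = n * (2 * Real.pi) := fun s => by
    obtain ⟨n, hn⟩ := exp_eq_exp_iff_exists_int.1 (h s)
    refine ⟨n, ?_⟩
    have : ((f s : ℂ) - g s) * I = (n * (2 * Real.pi)) * I := by linear_combination hn
    have := mul_right_cancel₀ I_ne_zero this
    exact_mod_cast this
  choose n hn using hn
  have hc : Continuous n := by
    rw [Int.isClosedEmbedding_coe_real.isInducing.continuous_iff]
    have : (Int.cast ∘ n : ℝ → ℝ) = fun s => (f s - g s) / (2 * Real.pi) := by
      funext s
      have := Real.pi_ne_zero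
      simp only [Function.comp_apply, hn]
      field_simp
    rw [this]
    fun_prop
  rw [hn, hn, PreconnectedSpace.constant inferInstance hc]

/-- If the total curvature over a period vanishes, the Maslov index is zero. -/
theorem IsUnitSpeedLegendrian.isMaslovIndex_iff (h : IsUnitSpeedLegendrian γ) {κ : ℝ → ℝ} {L : ℝ}
    (hκ : ∀ s, HasDerivAt κ (curvature γ s) s) (hκL : Function.Periodic κ L) (μ : ℤ) :
    IsMaslovIndex γ L μ ↔ μ = 0 := by
  obtain ⟨c, hc⟩ := h.frameDet_eq hκ
  have hκc : Continuous κ := continuous_iff_continuousAt.2 fun s => (hκ s).continuousAt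
  constructor
  · rintro ⟨θ, hθ, hγ, hL⟩
    have hdet : ∀ s, cexp (θ s * I) = cexp ((c + κ s : ℝ) * I) := fun s => by
      rw [← hc, frameDet, hγ s]
      have h1 := h.mem_sphere s
      rw [inner_C2] at h1
      simp [starVec]
      linear_combination (-cexp (θ s * I)) * h1
    have h1 := eq_of_cexp_mul_I_eq hθ (by fun_prop : Continuous fun s => c + κ s) hdet (0 + L) 0
    simp only [hκL 0, hL 0] at h1
    have h2 : 2 * Real.pi * (μ : ℝ) = 0 := by linarith
    have := Real.pi_ne_zero
    simpa [this] using h2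
  · rintro rfl
    refine ⟨fun s => c + κ s, by fun_prop, fun s => ?_, fun s => ?_⟩
    · rw [← hc]
      exact h.deriv_eq_frameDet_smul s
    · simp [hκL s]

end Legendrian

/-! ### Floquet multipliers -/

theorem exists_nat_mul_of_isLeast_period {f : ℝ → ℝ} {w T : ℝ}
    (hw : IsLeast {T : ℝ | 0 < T ∧ Function.Periodic f T} w) (hT : 0 < T)
    (hf : Function.Periodic f T) : ∃ n : ℕ, 0 < n ∧ T = n * w := by
  have hw0 := hw.1.1
  have hn : ((⌊T / w⌋₊ : ℕ) : ℝ) ≤ T / w := Nat.floor_le (by positivity)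
  have hn' : T / w < ⌊T / w⌋₊ + 1 := Nat.lt_floor_add_one _
  rw [le_div_iff₀ hw0] at hn
  rw [div_lt_iff₀ hw0] at hn'
  have hper : Function.Periodic f (T - ⌊T / w⌋₊ * w) := hf.sub_period (hw.1.2.nat_mul _)
  have heq : T = ⌊T / w⌋₊ * w := by
    rcases hn.lt_or_eq with hlt | heq
    · have := hw.2 ⟨sub_pos.2 hlt, hper⟩
      linarith
    · exact heq.symm
  refine ⟨⌊T / w⌋₊, Nat.pos_of_ne_zero fun h0 => ?_, heq⟩
  rw [h0] at heq
  simp at heq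
  exact hT.ne' heq

theorem periodic_curvature {γ : ℝ → C2} {T : ℝ} (hT : Function.Periodic γ T) :
    Function.Periodic (curvature γ) T := by
  intro s
  have h1 : ∀ s, deriv γ (s + T) = deriv γ s := fun s => by
    rw [← deriv_comp_add_const, show (fun s => γ (s + T)) = γ from funext hT]
  have h2 : deriv (deriv γ) (s + T) = deriv (deriv γ) s := by
    rw [← deriv_comp_add_const, show (fun s => deriv γ (s + T)) = deriv γ from funext h1]
  rw [curvature, curvature, h1, h2]

theorem apply_add_nat_mul_of_multiplier {p : ℝ → ℂ} {w : ℝ} {μ : ℂ}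
    (h : ∀ s, p (s + w) = μ * p s) (n : ℕ) (s : ℝ) : p (s + n * w) = μ ^ n * p s := by
  induction n with
  | zero => simp
  | succ n ih =>
    rw [show s + ((n + 1 : ℕ) : ℝ) * w = s + n * w + w by push_cast; ring, h, ih, pow_succ]
    ring

/-- A unit-speed Legendrian curve whose curvature has least period `w` and vanishing total
curvature over it is closed if and only if its Floquet multiplier is a root of unity. -/
theorem IsUnitSpeedLegendrian.isClosedCurve_iff {γ : ℝ → C2} (h : IsUnitSpeedLegendrian γ)
    {w : ℝ} (hw : IsLeast {T : ℝ | 0 < T ∧ Function.Periodic (curvature γ) T} w)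
    {κ : ℝ → ℝ} (hκ : ∀ s, HasDerivAt κ (curvature γ s) s) (hκw : Function.Periodic κ w)
    {p q : ℝ → ℂ} (H : IsFrameSolution (curvature γ) p q) (hne : ∃ s, p s ≠ 0) {μ : ℂ}
    (hp : ∀ s, p (s + w) = μ * p s) (hq : ∀ s, q (s + w) = μ * q s) :
    IsClosedCurve γ ↔ ∃ n : ℕ, 0 < n ∧ μ ^ n = 1 := by
  constructor
  · rintro ⟨L, hL⟩
    obtain ⟨n, hn, hLn⟩ := exists_nat_mul_of_isLeast_period hw hL.1.1 (periodic_curvature hL.1.2)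
    refine ⟨n, hn, ?_⟩
    obtain ⟨s, hs⟩ := hne
    -- The Floquet solution is a fixed linear combination of the components of `γ`, so it inherits
    -- the period `L = n w`.
    obtain ⟨w₀, w₁, hw⟩ := h.frameSolution_eq H
    have h1 := apply_add_nat_mul_of_multiplier hp n s
    rw [← hLn, hw (s + L), hL.1.2 s, ← hw s] at h1
    exact mul_right_cancel₀ hs (by rw [one_mul]; exact h1.symm)
  · rintro ⟨n, hn, hμ⟩
    have hper : Function.Periodic γ (n * w) := by
      intro s
      ext j
      refine H.periodic_of_periodic hne hκ (fun s => ?_) (fun s => ?_) (hκw.nat_mul n)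
        (h.isFrameSolution j) s
      · rw [apply_add_nat_mul_of_multiplier hp, hμ, one_mul]
      · rw [apply_add_nat_mul_of_multiplier hq, hμ, one_mul]
    -- Every period of `γ` is a multiple of `w`, so the least multiple that is a period is the
    -- minimal period.
    have hex : ∃ n : ℕ, 0 < n ∧ Function.Periodic γ (n * w) := ⟨n, hn, hper⟩
    classical
    obtain ⟨hm, hmper⟩ := Nat.find_spec hex
    have hw0 := hw.1.1
    refine ⟨Nat.find hex * w, ⟨by positivity, hmper⟩, fun T hT => ?_⟩
    obtain ⟨l, hl, rfl⟩ := exists_nat_mul_of_isLeast_period hw hT.1 (periodic_curvature hT.2)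
    have : Nat.find hex ≤ l := Nat.find_min' hex ⟨hl, hT.2⟩
    gcongr

/-- Knowing `μ` only up to sign suffices, since `μ` is a root of unity if and only if `μ²` is. -/
theorem exists_pow_eq_one_iff_rational {μ : ℂ} {x : ℝ}
    (hμ : μ ^ 2 = cexp (-(4 * Real.pi * x) * I)) :
    (∃ n : ℕ, 0 < n ∧ μ ^ n = 1) ↔ ∃ q : ℚ, x = q := by
  have hpi : (Real.pi : ℂ) ≠ 0 := ofReal_ne_zero.2 Real.pi_ne_zero
  constructor
  · rintro ⟨n, hn, h⟩
    have h1 : cexp (n * (-(4 * Real.pi * x) * I)) = 1 := by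
      rw [exp_nat_mul, ← hμ, ← pow_mul, mul_comm, pow_mul, h, one_pow]
    obtain ⟨m, hm⟩ := exp_eq_one_iff.1 h1
    have hn0 : (n : ℝ) ≠ 0 := by positivity
    refine ⟨-m / (2 * n), ?_⟩
    have h2 : ((n * x * 2 : ℝ) : ℂ) = ((-m : ℝ) : ℂ) := by
      have : (2 * Real.pi * I) * (n * x * 2) = (2 * Real.pi * I) * (-m) := by
        linear_combination -hm
      have := mul_left_cancel₀ (by simp [hpi] : (2 * Real.pi * I : ℂ) ≠ 0) this
      push_cast
      exact this
    have h3 := ofReal_injective h2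
    push_cast
    rw [eq_div_iff (by positivity)]
    linarith
  · rintro ⟨r, rfl⟩
    refine ⟨2 * r.den, by have := r.pos; positivity, ?_⟩
    rw [pow_mul, hμ, ← exp_nat_mul, exp_eq_one_iff]
    refine ⟨-2 * r.num, ?_⟩
    have hr : (r.den : ℂ) * ((r : ℝ) : ℂ) = r.num := by
      have := Rat.den_mul_eq_num r
      rw [ofReal_ratCast]
      exact_mod_cast this
    push_cast
    push_cast at hr
    linear_combination (-(4 * Real.pi * I)) * hr

/-! ### φ-curves -/

section DuffingUniqueness

/-- Bounded solutions of `f'' = -f³/2 - a f` are determined by their initial data. -/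
theorem duffing_unique {a M : ℝ} {f f₁ g g₁ : ℝ → ℝ}
    (hf : ∀ s, HasDerivAt f (f₁ s) s) (hf₁ : ∀ s, HasDerivAt f₁ (-f s ^ 3 / 2 - a * f s) s)
    (hg : ∀ s, HasDerivAt g (g₁ s) s) (hg₁ : ∀ s, HasDerivAt g₁ (-g s ^ 3 / 2 - a * g s) s)
    (hfM : ∀ s, |f s| ≤ M ∧ |f₁ s| ≤ M) (hgM : ∀ s, |g s| ≤ M ∧ |g₁ s| ≤ M)
    {s₀ : ℝ} (h0 : f s₀ = g s₀) (h1 : f₁ s₀ = g₁ s₀) : f = g := by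
  let v : ℝ × ℝ → ℝ × ℝ := fun x => (x.2, -x.1 ^ 3 / 2 - a * x.1)
  have hv : ContDiff ℝ 1 v := by fun_prop
  -- The cubic field is not globally Lipschitz, but both orbits stay in a compact convex ball, on
  -- which it is.
  obtain ⟨K, hK⟩ := hv.contDiffOn.exists_lipschitzOnWith one_ne_zero
    (convex_closedBall (0 : ℝ × ℝ) M) (isCompact_closedBall 0 M)
  have hmem : ∀ {x y : ℝ}, |x| ≤ M ∧ |y| ≤ M → (x, y) ∈ Metric.closedBall (0 : ℝ × ℝ) M := by
    intro x y h
    rw [mem_closedBall_zero_iff, Prod.norm_mk]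
    exact max_le h.1 h.2
  have := ODE_solution_unique_univ (v := fun _ => v) (s := fun _ => Metric.closedBall 0 M)
    (f := fun s => (f s, f₁ s)) (g := fun s => (g s, g₁ s)) (t₀ := s₀) (fun _ => hK)
    (fun t => ⟨(hf t).prodMk (hf₁ t), hmem (hfM t)⟩)
    (fun t => ⟨(hg t).prodMk (hg₁ t), hmem (hgM t)⟩) (by simp only [h0, h1])
  funext s
  exact congrArg Prod.fst (congrFun this s)

end DuffingUniqueness

/-! ### Identification of the curvature of a φ-curve. -/

section PhiCurve

variable {e : ℝ × ℝ} {γ : ℝ → C2}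

theorem phiCurvature_phase (e : ℝ × ℝ) (s : ℝ) :
    (e.1 * Real.sin (phiAngle e s) * phiR e (phiAngle e s) / 2) ^ 2 =
      (e.1 ^ 2 - phiCurvature e s ^ 2) * (e.2 ^ 2 + phiCurvature e s ^ 2) / 4 := by
  rw [phiCurvature_eq, div_pow, mul_pow, mul_pow, phiR_sq, Real.sin_sq]
  ring

theorem abs_le_of_phase {e : ℝ × ℝ} (he : e ∈ C0) {x y : ℝ}
    (h : y ^ 2 = (e.1 ^ 2 - x ^ 2) * (e.2 ^ 2 + x ^ 2) / 4) :
    |x| ≤ e.1 + (e.1 ^ 2 + e.2 ^ 2) ∧ |y| ≤ e.1 + (e.1 ^ 2 + e.2 ^ 2) ∧ |x| ≤ e.1 := by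
  have h1 := he.1
  have h2 := he.2
  have hx : x ^ 2 ≤ e.1 ^ 2 := by
    by_contra hlt
    push Not at hlt
    have : 0 < e.2 ^ 2 + x ^ 2 := by positivity
    nlinarith [sq_nonneg y]
  have hx' : |x| ≤ e.1 := abs_le_of_sq_le_sq hx h1.le
  have hy : |y| ≤ e.1 ^ 2 + e.2 ^ 2 := by
    refine abs_le_of_sq_le_sq ?_ (by positivity)
    nlinarith [mul_le_mul (by nlinarith [sq_nonneg x] : e.1 ^ 2 - x ^ 2 ≤ e.1 ^ 2 + e.2 ^ 2)
      (by nlinarith : e.2 ^ 2 + x ^ 2 ≤ e.1 ^ 2 + e.2 ^ 2) (by positivity) (by positivity)]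
  have : 0 < e.1 ^ 2 + e.2 ^ 2 := by positivity
  exact ⟨by linarith, by linarith, hx'⟩

theorem IsPhiCurve.mem_C0 (h : IsPhiCurve γ e) : e ∈ C0 :=
  ⟨by have := h.lt; linarith, h.pos⟩

theorem IsPhiCurve.hasDerivAt_curvature (h : IsPhiCurve γ e) (s : ℝ) :
    HasDerivAt (curvature γ) (deriv (curvature γ) s) s :=
  ((contDiff_infty_iff_deriv.1 h.sCurve.leg.contDiff_curvature).1 s).hasDerivAt

theorem IsPhiCurve.phase_eq (h : IsPhiCurve γ e) (s : ℝ) :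
    deriv (curvature γ) s ^ 2 =
      (e.1 ^ 2 - curvature γ s ^ 2) * (e.2 ^ 2 + curvature γ s ^ 2) / 4 := by
  have := h.phase s
  rw [phasePoly_cnoidal] at this
  linear_combination this

/-- The stationary equation makes `k'' + k³/2 + a k` constant. Differentiating the phase equation
shows that `2k'` times it vanishes, so the constant is zero, because `k' ≠ 0` somewhere. -/
theorem IsPhiCurve.hasDerivAt_deriv_curvature (h : IsPhiCurve γ e) (s : ℝ) :
    HasDerivAt (deriv (curvature γ))
      (-curvature γ s ^ 3 / 2 - (e.2 ^ 2 - e.1 ^ 2) / 4 * curvature γ s) s := by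
  have c1 := contDiff_infty_iff_deriv.1 h.sCurve.leg.contDiff_curvature
  have c2 := contDiff_infty_iff_deriv.1 c1.2
  have c3 := contDiff_infty_iff_deriv.1 c2.2
  have d1 := fun s => (c1.1 s).hasDerivAt
  have d2 := fun s => (c2.1 s).hasDerivAt
  have d3 := fun s => (c3.1 s).hasDerivAt
  set k := curvature γ with hk
  have hG : ∀ s, HasDerivAt (fun s => deriv (deriv k) s + k s ^ 3 / 2 +
      (e.2 ^ 2 - e.1 ^ 2) / 4 * k s) 0 s := fun s => by
    refine (((d3 s).fun_add (((d1 s).fun_pow 3).div_const 2)).fun_add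
      ((d1 s).const_mul _)).congr_deriv ?_
    have := h.stationary s
    rw [cnoidalA_neg] at this
    push_cast
    linear_combination this
  have hconst := is_const_of_deriv_eq_zero (fun s => (hG s).differentiableAt)
    fun s => (hG s).deriv
  obtain ⟨s₁, hs₁⟩ : ∃ s₁, deriv k s₁ ≠ 0 := by
    by_contra hno
    push Not at hno
    exact h.sCurve.nonconst ⟨k 0, fun s => is_const_of_deriv_eq_zero c1.1 hno s 0⟩
  have hphase : 2 * deriv k s₁ * (deriv (deriv k) s₁ + k s₁ ^ 3 / 2 +
      (e.2 ^ 2 - e.1 ^ 2) / 4 * k s₁) = 0 := by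
    have hz : HasDerivAt (fun s => deriv k s ^ 2 -
        (e.1 ^ 2 - k s ^ 2) * (e.2 ^ 2 + k s ^ 2) / 4)
        (2 * deriv k s₁ * (deriv (deriv k) s₁ + k s₁ ^ 3 / 2 +
          (e.2 ^ 2 - e.1 ^ 2) / 4 * k s₁)) s₁ := by
      refine (((d2 s₁).fun_pow 2).fun_sub (((((d1 s₁).fun_pow 2).const_sub (e.1 ^ 2)).fun_mul
        (((d1 s₁).fun_pow 2).const_add (e.2 ^ 2))).div_const 4)).congr_deriv ?_
      push_cast
      ring
    rw [show (fun s => deriv k s ^ 2 - (e.1 ^ 2 - k s ^ 2) * (e.2 ^ 2 + k s ^ 2) / 4) =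
      fun _ => (0 : ℝ) from funext fun s => sub_eq_zero.2 (h.phase_eq s)] at hz
    exact hz.unique (hasDerivAt_const s₁ (0 : ℝ))
  have hG1 := (mul_eq_zero.1 hphase).resolve_left (mul_ne_zero two_ne_zero hs₁)
  have hG2 := (hconst s s₁).trans hG1
  exact (d2 s).congr_deriv (by linarith)

theorem exists_phiAngle_eq (he : e ∈ C0) (φ : ℝ) : ∃ s, phiAngle e s = φ :=
  ⟨_, phiAngle_ellipticF he φ⟩

/-- Every point of the phase curve is attained by `phiCurvature`. -/
theorem exists_phiCurvature_eq (he : e ∈ C0) {x y : ℝ}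
    (h : y ^ 2 = (e.1 ^ 2 - x ^ 2) * (e.2 ^ 2 + x ^ 2) / 4) :
    ∃ s, phiCurvature e s = x ∧ e.1 * Real.sin (phiAngle e s) * phiR e (phiAngle e s) / 2 = y := by
  have h1 := he.1
  have hx := abs_le.1 (abs_le_of_phase he h).2.2
  have hcos : Real.cos (Real.arccos (-x / e.1)) = -x / e.1 := by
    refine Real.cos_arccos ?_ ?_
    · rw [le_div_iff₀ h1]; linarith
    · rw [div_le_iff₀ h1]; linarith
  -- The phase equation fixes `y` up to sign; opposite amplitudes give the same curvature and
  -- opposite derivatives.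
  obtain ⟨s, hs⟩ := exists_phiAngle_eq he (Real.arccos (-x / e.1))
  obtain ⟨t, ht⟩ := exists_phiAngle_eq he (-Real.arccos (-x / e.1))
  have hsx : phiCurvature e s = x := by
    rw [phiCurvature_eq, hs, hcos]
    field_simp
  have htx : phiCurvature e t = x := by
    rw [phiCurvature_eq, ht, Real.cos_neg, hcos]
    field_simp
  have hst : e.1 * Real.sin (phiAngle e t) * phiR e (phiAngle e t) / 2 =
      -(e.1 * Real.sin (phiAngle e s) * phiR e (phiAngle e s) / 2) := by
    rw [ht, hs, Real.sin_neg, phiR, phiR, Real.cos_neg]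
    ring
  have hsq := phiCurvature_phase e s
  rw [hsx, ← h] at hsq
  rcases sq_eq_sq_iff_eq_or_eq_neg.1 hsq with hy | hy
  · exact ⟨s, hsx, hy⟩
  · exact ⟨t, htx, by rw [hst, hy, neg_neg]⟩

theorem IsPhiCurve.exists_curvature_add_eq (h : IsPhiCurve γ e) :
    ∃ s₀ : ℝ, ∀ s, curvature γ (s + s₀) = phiCurvature e s := by
  have he := h.mem_C0
  obtain ⟨t, ht0, ht1⟩ := exists_phiCurvature_eq he (h.phase_eq 0)
  refine ⟨-t, fun s => ?_⟩
  have hb := fun s => abs_le_of_phase he (h.phase_eq (s + -t))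
  have hb' := fun s => abs_le_of_phase he (phiCurvature_phase e s)
  have := duffing_unique (s₀ := t)
    (fun s => (h.hasDerivAt_curvature (s + -t)).comp_add_const s (-t))
    (fun s => (h.hasDerivAt_deriv_curvature (s + -t)).comp_add_const s (-t))
    (hasDerivAt_phiCurvature he) (hasDerivAt_deriv_phiCurvature he)
    (fun s => ⟨(hb s).1, (hb s).2.1⟩) (fun s => ⟨(hb' s).1, (hb' s).2.1⟩)
    (by rw [add_neg_cancel, ht0]) (by rw [add_neg_cancel, ht1])
  exact congrFun this s

end PhiCurve

/-! ### Explicit solutions of the frame equation -/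

open Complex ComplexConjugate

/-- For `p = r e^{-iσ}` with `σ' = τ`, the hypotheses `hr₁` and `h` are the real and imaginary parts
of the frame equation. -/
theorem isFrameSolution_polar {k r r₁ τ τ₁ σ : ℝ → ℝ} (hr : ∀ s, HasDerivAt r (r₁ s) s)
    (hr₁ : ∀ s, HasDerivAt r₁ ((τ s ^ 2 + k s * τ s - 1) * r s) s)
    (hτ : ∀ s, HasDerivAt τ (τ₁ s) s) (hσ : ∀ s, HasDerivAt σ (τ s) s)
    (h : ∀ s, τ₁ s * r s + 2 * τ s * r₁ s = -(k s * r₁ s)) :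
    IsFrameSolution k (fun s => r s * cexp (-(σ s * I)))
      fun s => (r₁ s - τ s * r s * I) * cexp (-(σ s * I)) := fun s => by
  have hE : HasDerivAt (fun s => cexp (-(σ s * I))) (cexp (-(σ s * I)) * -(τ s * I)) s :=
    ((hσ s).ofReal_comp.mul_const I).fun_neg.cexp
  constructor
  · refine ((hr s).ofReal_comp.fun_mul hE).congr_deriv ?_
    ring
  · refine (((hr₁ s).ofReal_comp.fun_sub
      (((hτ s).ofReal_comp.fun_mul (hr s).ofReal_comp).mul_const I)).fun_mul hE).congr_deriv ?_
    have h' : (τ₁ s * r s + 2 * τ s * r₁ s : ℂ) = -(k s * r₁ s) := by exact_mod_cast h s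
    push_cast
    linear_combination (-I * cexp (-(σ s * I))) * h' +
      (τ s ^ 2 * r s + k s * τ s * r s) * cexp (-(σ s * I)) * I_sq

/-- A solution of the frame equation which is multiplied by `μ` over each period. -/
structure IsFloquetSolution (k : ℝ → ℝ) (T : ℝ) (μ : ℂ) (p q : ℝ → ℂ) : Prop where
  sol : IsFrameSolution k p q
  ne_zero : ∃ s, p s ≠ 0
  left : ∀ s, p (s + T) = μ * p s
  right : ∀ s, q (s + T) = μ * q s

theorem exists_floquet_polar {k r r₁ τ τ₁ : ℝ → ℝ} {T ε : ℝ} (hr : ∀ s, HasDerivAt r (r₁ s) s)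
    (hr₁ : ∀ s, HasDerivAt r₁ ((τ s ^ 2 + k s * τ s - 1) * r s) s)
    (hτ : ∀ s, HasDerivAt τ (τ₁ s) s)
    (h : ∀ s, τ₁ s * r s + 2 * τ s * r₁ s = -(k s * r₁ s)) (hne : ∃ s, r s ≠ 0)
    (hε : ε ^ 2 = 1) (hrT : ∀ s, r (s + T) = ε * r s) (hr₁T : ∀ s, r₁ (s + T) = ε * r₁ s)
    (hτT : Function.Periodic τ T) :
    ∃ μ p q, μ ^ 2 = cexp (-(2 * (∫ s in (0 : ℝ)..T, τ s : ℝ)) * I) ∧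
      IsFloquetSolution k T μ p q := by
  have hc : Continuous τ := continuous_iff_continuousAt.2 fun s => (hτ s).continuousAt
  let σ : ℝ → ℝ := fun s => ∫ t in (0 : ℝ)..s, τ t
  have hσ : ∀ s, HasDerivAt σ (τ s) s := fun s => (hc.integral_hasStrictDerivAt 0 s).hasDerivAt
  have hσT : ∀ s, σ (s + T) = σ s + ∫ t in (0 : ℝ)..T, τ t := fun s => by
    have h1 := hτT.intervalIntegral_add_eq s 0
    rw [zero_add] at h1
    rw [← h1]
    exact (intervalIntegral.integral_add_adjacent_intervals (hc.intervalIntegrable _ _)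
      (hc.intervalIntegrable _ _)).symm
  have hE : ∀ s, cexp (-(σ (s + T) * I)) =
      cexp (-((∫ t in (0 : ℝ)..T, τ t : ℝ) * I)) * cexp (-(σ s * I)) := fun s => by
    rw [hσT, ← exp_add]
    congr 1
    push_cast
    ring
  refine ⟨ε * cexp (-((∫ t in (0 : ℝ)..T, τ t : ℝ) * I)), _, _, ?_,
    isFrameSolution_polar hr hr₁ hτ hσ h, ?_, fun s => ?_, fun s => ?_⟩
  · rw [mul_pow, ← exp_nat_mul, ← ofReal_pow, hε, ofReal_one, one_mul]
    congr 1
    push_cast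
    ring
  · obtain ⟨s, hs⟩ := hne
    exact ⟨s, mul_ne_zero (ofReal_ne_zero.2 hs) (exp_ne_zero _)⟩
  · rw [hE, hrT]
    push_cast
    ring
  · rw [hE, hrT, hr₁T, hτT]
    push_cast
    ring

section Floquet

variable {e : ℝ × ℝ}

/-- Here `2k + λ = 4e₁ sin²(φ/2)` with `φ` the amplitude. Its smooth root is proportional to
`sin(φ/2)`, which changes sign over a wavelength, hence `ε = -1`. -/
theorem exists_floquet_of_modNorm_eq (he : e ∈ C0) (h : modNorm e = 4) :
    ∃ μ p q, μ ^ 2 = cexp (-(4 * Real.pi * Phi2 e) * I) ∧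
      IsFloquetSolution (phiCurvature e) (wavelength e) μ p q := by
  have h16 := (modNorm_eq_four_iff he).1 h
  have hφ := hasDerivAt_phiAngle he
  have hk := hasDerivAt_phiCurvature he
  have hkc := continuous_phiCurvature he
  have hint : ∫ s in (0 : ℝ)..wavelength e, (e.1 - phiCurvature e s) / 4 =
      2 * Real.pi * Phi2 e := by
    rw [Phi2, integral_bigLambda_of_modNorm_eq he h, intervalIntegral.integral_div,
      intervalIntegral.integral_sub (by simp) (hkc.intervalIntegrable _ _),
      integral_phiCurvature he, intervalIntegral.integral_const, smul_eq_mul]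
    have := Real.pi_ne_zero
    field_simp
    ring
  obtain ⟨μ, p, q, hμ, hpq⟩ := exists_floquet_polar (k := phiCurvature e)
    (T := wavelength e) (ε := -1)
    (r := fun s => Real.sin (phiAngle e s / 2))
    (r₁ := fun s => Real.cos (phiAngle e s / 2) * phiR e (phiAngle e s) / 4)
    (τ := fun s => (e.1 - phiCurvature e s) / 4)
    (τ₁ := fun s => -(e.1 * Real.sin (phiAngle e s) * phiR e (phiAngle e s) / 2) / 4)
    (fun s => by
      refine ((hφ s).div_const 2).sin.congr_deriv ?_
      ring)
    (fun s => by
      refine ((((hφ s).div_const 2).cos.fun_mul (hasDerivAt_phiR_phiAngle he s)).div_const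
        4).congr_deriv ?_
      have hR := phiR_sq e (phiAngle e s)
      have hx : phiAngle e s = 2 * (phiAngle e s / 2) := by ring
      have hs : Real.sin (phiAngle e s) =
          2 * Real.sin (phiAngle e s / 2) * Real.cos (phiAngle e s / 2) := by
        conv_lhs => rw [hx, Real.sin_two_mul]
      have hc : Real.cos (phiAngle e s) = 2 * Real.cos (phiAngle e s / 2) ^ 2 - 1 := by
        conv_lhs => rw [hx, Real.cos_two_mul]
      rw [hc] at hR
      rw [phiCurvature_eq, hs, hc]
      linear_combination (-Real.sin (phiAngle e s / 2) / 16) * (hR + h16))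
    (fun s => ((hk s).const_sub e.1).div_const 4)
    (fun s => by
      have hx : phiAngle e s = 2 * (phiAngle e s / 2) := by ring
      have hs : Real.sin (phiAngle e s) =
          2 * Real.sin (phiAngle e s / 2) * Real.cos (phiAngle e s / 2) := by
        conv_lhs => rw [hx, Real.sin_two_mul]
      have hc : Real.cos (phiAngle e s) = 1 - 2 * Real.sin (phiAngle e s / 2) ^ 2 := by
        conv_lhs => rw [hx, Real.cos_two_mul, Real.cos_sq']
        ring
      rw [phiCurvature_eq, hs, hc]
      ring)
    (by
      obtain ⟨s, hs⟩ := exists_phiAngle_eq he Real.pi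
      exact ⟨s, by simp only [hs, Real.sin_pi_div_two]; exact one_ne_zero⟩)
    (by norm_num)
    (fun s => by
      rw [phiAngle_add_wavelength he, add_div, mul_div_cancel_left₀ _ (two_ne_zero),
        Real.sin_add_pi]
      ring)
    (fun s => by
      rw [phiAngle_add_wavelength he, add_div, mul_div_cancel_left₀ _ (two_ne_zero),
        Real.cos_add_pi, phiR, Real.cos_add_two_pi, ← phiR]
      ring)
    (fun s => by simp only [periodic_phiCurvature he s])
  refine ⟨μ, p, q, ?_, hpq⟩
  rw [hμ, hint]
  congr 1
  push_cast
  ring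

theorem two_mul_phiCurvature_add_phiLambda_pos (he : e ∈ C0) (h : modNorm e ≠ 4) (s : ℝ) :
    0 < 2 * phiCurvature e s + phiLambda e := by
  have := phiLambda_add_mul_cos_pos he h (x := -Real.cos (phiAngle e s))
    (by rw [abs_neg]; exact Real.abs_cos_le_one _)
  rw [phiCurvature_eq]
  linarith

/-- With `r² = 2k + λ`, the imaginary part of the frame equation reads `(r²τ)' = -k k'`, so `r²τ` is
a constant minus `k²/2`. The constant `4 - a` makes `τ = Λ - k/4`, and `k/4` has zero integral. -/
theorem exists_floquet_of_modNorm_ne (he : e ∈ C0) (h : modNorm e ≠ 4) :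
    ∃ μ p q, μ ^ 2 = cexp (-(4 * Real.pi * Phi2 e) * I) ∧
      IsFloquetSolution (phiCurvature e) (wavelength e) μ p q := by
  have hk := hasDerivAt_phiCurvature he
  have hk₁ := hasDerivAt_deriv_phiCurvature he
  have hkc := continuous_phiCurvature he
  have hper := periodic_phiCurvature he
  have hpos := two_mul_phiCurvature_add_phiLambda_pos he h
  have hphase := phiCurvature_phase e
  have hlam := phiLambda_sq e
  have hbig : ∀ s, bigLambda e s - phiCurvature e s / 4 =
      (4 - (e.2 ^ 2 - e.1 ^ 2) / 4 - phiCurvature e s ^ 2 / 2) /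
        (2 * phiCurvature e s + phiLambda e) := fun s => by
    have h1 := (hpos s).ne'
    rw [bigLambda_eq, lambdaCos, show phiLambda e - 2 * e.1 * Real.cos (phiAngle e s) =
      2 * phiCurvature e s + phiLambda e by rw [phiCurvature_eq]; ring, eq_div_iff h1, sub_mul,
      div_mul_cancel₀ _ h1, phiCurvature_eq]
    ring
  have hint : ∫ s in (0 : ℝ)..wavelength e,
      (4 - (e.2 ^ 2 - e.1 ^ 2) / 4 - phiCurvature e s ^ 2 / 2) /
        (2 * phiCurvature e s + phiLambda e) = 2 * Real.pi * Phi2 e := by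
    simp only [← hbig]
    rw [intervalIntegral.integral_sub (intervalIntegrable_bigLambda he _ _)
      ((hkc.div_const 4).intervalIntegrable _ _), intervalIntegral.integral_div,
      integral_phiCurvature he, Phi2]
    have := Real.pi_ne_zero
    field_simp
    ring
  set k := phiCurvature e with hkdef
  set k₁ : ℝ → ℝ := fun s => e.1 * Real.sin (phiAngle e s) * phiR e (phiAngle e s) / 2 with hk₁def
  have hk₁per : Function.Periodic k₁ (wavelength e) := fun s => by
    simp only [hk₁def, phiAngle_add_wavelength he, phiR, Real.cos_add_two_pi, Real.sin_add_two_pi]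
  let r : ℝ → ℝ := fun s => Real.sqrt (2 * k s + phiLambda e)
  have hr0 : ∀ s, r s ≠ 0 := fun s => (Real.sqrt_pos.2 (hpos s)).ne'
  have hr2 : ∀ s, r s ^ 2 = 2 * k s + phiLambda e := fun s => Real.sq_sqrt (hpos s).le
  have hr : ∀ s, HasDerivAt r (k₁ s / r s) s := fun s => by
    refine ((((hk s).const_mul 2).add_const (phiLambda e)).sqrt (hpos s).ne').congr_deriv ?_
    exact mul_div_mul_left _ _ two_ne_zero
  have hrper : Function.Periodic r (wavelength e) := fun s => by simp only [r, hper s]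
  obtain ⟨μ, p, q, hμ, hpq⟩ := exists_floquet_polar (k := k) (T := wavelength e) (ε := 1)
    (r := r) (r₁ := fun s => k₁ s / r s)
    (τ := fun s => (4 - (e.2 ^ 2 - e.1 ^ 2) / 4 - k s ^ 2 / 2) / (2 * k s + phiLambda e))
    (τ₁ := fun s => (-(k s * k₁ s) * (2 * k s + phiLambda e) -
      (4 - (e.2 ^ 2 - e.1 ^ 2) / 4 - k s ^ 2 / 2) * (2 * k₁ s)) / (2 * k s + phiLambda e) ^ 2)
    hr
    (fun s => by
      refine ((hk₁ s).fun_div (hr s) (hr0 s)).congr_deriv ?_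
      have h1 := hr0 s
      have h2 := hr2 s
      have h3 : k₁ s ^ 2 = _ := hphase s
      have h4 : phiLambda e = r s ^ 2 - 2 * k s := by linarith
      rw [← h2]
      field_simp
      rw [h4] at hlam
      rw [h3]
      -- Once `k'²` is eliminated by the phase equation, the real part reduces to the formula for
      -- `λ²`.
      linear_combination 4 * hlam)
    (fun s => by
      refine ((((hk s).fun_pow 2).div_const 2).const_sub _ |>.fun_div
        (((hk s).const_mul 2).add_const (phiLambda e)) (hpos s).ne').congr_deriv ?_
      push_cast
      ring)
    (fun s => by
      have h1 := hr0 s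
      simp only [← hr2 s]
      field_simp
      ring)
    ⟨0, hr0 0⟩ (by norm_num)
    (fun s => by rw [hrper s, one_mul])
    (fun s => by rw [hrper s, hk₁per s, one_mul])
    (fun s => by simp only [hper s])
  refine ⟨μ, p, q, ?_, hpq⟩
  rw [hμ, hint]
  congr 1
  push_cast
  ring

theorem exists_floquet (he : e ∈ C0) :
    ∃ μ p q, μ ^ 2 = cexp (-(4 * Real.pi * Phi2 e) * I) ∧
      IsFloquetSolution (phiCurvature e) (wavelength e) μ p q := by
  by_cases h : modNorm e = 4
  · exact exists_floquet_of_modNorm_eq he h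
  · exact exists_floquet_of_modNorm_ne he h

end Floquet

/-! ### Closure and Maslov index -/

section Closure

variable {e : ℝ × ℝ} {γ : ℝ → C2}

theorem IsPhiCurve.exists_curvature_eq_sub (h : IsPhiCurve γ e) :
    ∃ s₀ : ℝ, curvature γ = fun s => phiCurvature e (s - s₀) := by
  obtain ⟨s₀, hs₀⟩ := h.exists_curvature_add_eq
  exact ⟨s₀, funext fun s => by rw [← hs₀, sub_add_cancel]⟩

theorem IsPhiCurve.isLeast_period (h : IsPhiCurve γ e) :
    IsLeast {T : ℝ | 0 < T ∧ Function.Periodic (curvature γ) T} (wavelength e) := by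
  obtain ⟨s₀, hs₀⟩ := h.exists_curvature_add_eq
  have hiff : ∀ T, Function.Periodic (curvature γ) T ↔ Function.Periodic (phiCurvature e) T := by
    intro T
    constructor
    · intro hT s
      rw [← hs₀, ← hs₀, add_right_comm, hT]
    · intro hT s
      have := hT (s - s₀)
      rwa [← hs₀, ← hs₀, sub_add_cancel, show s - s₀ + T + s₀ = s + T by ring] at this
  simp only [hiff]
  exact isLeast_period_phiCurvature h.mem_C0

theorem IsPhiCurve.exists_antideriv (h : IsPhiCurve γ e) :
    ∃ κ : ℝ → ℝ, (∀ s, HasDerivAt κ (curvature γ s) s) ∧ Function.Periodic κ (wavelength e) := by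
  have hc : Continuous (curvature γ) := h.sCurve.leg.contDiff_curvature.continuous
  obtain ⟨s₀, hs₀⟩ := h.exists_curvature_add_eq
  refine ⟨fun s => ∫ t in (0 : ℝ)..s, curvature γ t,
    fun s => (hc.integral_hasStrictDerivAt 0 s).hasDerivAt, fun s => ?_⟩
  have h1 := h.isLeast_period.1.2.intervalIntegral_add_eq s s₀
  have h2 : ∫ t in s₀..(s₀ + wavelength e), curvature γ t = 0 := by
    rw [← integral_phiCurvature h.mem_C0]
    simp only [← hs₀]
    rw [intervalIntegral.integral_comp_add_right (fun t => curvature γ t)]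
    congr 1 <;> ring
  rw [h2] at h1
  have h3 := intervalIntegral.integral_add_adjacent_intervals (hc.intervalIntegrable 0 s)
    (hc.intervalIntegrable s (s + wavelength e)) (μ := MeasureTheory.volume)
  rw [h1, add_zero] at h3
  exact h3.symm

theorem IsPhiCurve.isClosedCurve_iff (h : IsPhiCurve γ e) :
    IsClosedCurve γ ↔ ∃ q : ℚ, Phi2 e = (q : ℝ) := by
  obtain ⟨κ, hκ, hκw⟩ := h.exists_antideriv
  obtain ⟨s₀, hs₀⟩ := h.exists_curvature_eq_sub
  obtain ⟨μ, p, q, hμ, hpq⟩ := exists_floquet h.mem_C0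
  have hsol : IsFrameSolution (curvature γ) (fun s => p (s - s₀)) fun s => q (s - s₀) := by
    rw [hs₀]
    exact hpq.sol.comp_sub_const s₀
  obtain ⟨s₁, hs₁⟩ := hpq.ne_zero
  rw [← exists_pow_eq_one_iff_rational hμ]
  exact h.sCurve.leg.isClosedCurve_iff h.isLeast_period hκ hκw hsol
    ⟨s₁ + s₀, by simpa using hs₁⟩
    (fun s => by rw [add_sub_right_comm, hpq.left])
    (fun s => by rw [add_sub_right_comm, hpq.right])

theorem Phi2_rational_iff_Phi2Reg_rational (e : ℝ × ℝ) :
    (∃ q : ℚ, Phi2 e = (q : ℝ)) ↔ ∃ q : ℚ, Phi2Reg e = (q : ℝ) := by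
  obtain ⟨r, hr⟩ : ∃ r : ℚ, Phi2Reg e = Phi2 e + r := by
    unfold Phi2Reg
    split_ifs
    · exact ⟨0, by simp⟩
    · exact ⟨1 / 2, by simp⟩
    · exact ⟨1, by simp⟩
  rw [hr]
  constructor
  · rintro ⟨q, hq⟩
    exact ⟨q + r, by rw [hq]; push_cast; rfl⟩
  · rintro ⟨q, hq⟩
    exact ⟨q - r, by push_cast; linarith⟩

theorem IsPhiCurve.isMaslovIndex_iff (h : IsPhiCurve γ e) {L : ℝ} (hL : IsClosedOfPeriod γ L)
    (μ : ℤ) : IsMaslovIndex γ L μ ↔ μ = 0 := by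
  obtain ⟨κ, hκ, hκw⟩ := h.exists_antideriv
  obtain ⟨n, -, rfl⟩ := exists_nat_mul_of_isLeast_period h.isLeast_period hL.1.1
    (periodic_curvature hL.1.2)
  exact h.sCurve.leg.isMaslovIndex_iff hκ (hκw.nat_mul n) μ

end Closure

end LegendrianS3

theorem mainTheorem12 :
    -- the quanta of a modulus, and the regularized quantum
    (∀ e ∈ C0,
      IntervalIntegrable (phiCurvature e) MeasureTheory.volume 0 (wavelength e) ∧
      Phi1 e = 0 ∧
      IntervalIntegrable (bigLambda e) MeasureTheory.volume 0 (wavelength e) ∧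
      (modNorm e ≠ 4 →
        Phi2 e = phiLambda e / (2 * Real.pi * modNorm e) *
          (ellipticK (phiM e) - (modNorm e ^ 2 + 16) / (modNorm e ^ 2 - 16) *
            ellipticPi (-64 * e.1 ^ 2 / (modNorm e ^ 2 - 16) ^ 2) (phiM e))) ∧
      (modNorm e = 4 →
        Phi2 e = e.1 / (4 * Real.pi) * ellipticK (e.1 ^ 2 / 16))) ∧
    AnalyticOnNhd ℝ Phi2Reg C0 ∧
    -- φ-curves: curvature, wavelength, closure and Maslov index
    (∀ (e : ℝ × ℝ) (γ : ℝ → C2), IsPhiCurve γ e →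
      e ∈ C0 ∧
      (∃ s₀ : ℝ, ∀ s, curvature γ (s + s₀) = phiCurvature e s) ∧
      IsLeast {T : ℝ | 0 < T ∧ Function.Periodic (curvature γ) T} (wavelength e) ∧
      (IsClosedCurve γ ↔ ∃ q : ℚ, Phi2 e = (q : ℝ)) ∧
      (IsClosedCurve γ ↔ ∃ q : ℚ, Phi2Reg e = (q : ℝ)) ∧
      (∀ L : ℝ, IsClosedOfPeriod γ L → ∀ μ : ℤ, IsMaslovIndex γ L μ ↔ μ = 0)) := by
  refine ⟨fun e he => ⟨(continuous_phiCurvature he).intervalIntegrable _ _, ?_,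
    intervalIntegrable_bigLambda he _ _, Phi2_of_modNorm_ne he, Phi2_of_modNorm_eq he⟩,
    analyticOnNhd_Phi2Reg, fun e γ h => ⟨h.mem_C0, h.exists_curvature_add_eq, h.isLeast_period,
      h.isClosedCurve_iff, ?_, fun L hL μ => h.isMaslovIndex_iff hL μ⟩⟩
  · rw [Phi1, integral_phiCurvature he, mul_zero]
  · rw [← Phi2_rational_iff_Phi2Reg_rational]
    exact h.isClosedCurve_iff
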